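/- Let $X$ be a locally compact Polish space with Borel $\sigma$-algebra $\mathcal B(X)$, let $\mathbb M(X)$ be the space of nonnegative Radon measures on $X$ with the Borel $\sigma$-algebra of the vague topology, and let $\mathbb K(X)\subset\mathbb M(X)$ be the set of discrete Radon measures $\eta=\sum_i s_i\delta_{x_i}$ (at most countably many terms, $s_i>0$, the $x_i$ distinct). Put $\mathbb R_+:=(0,\infty)$, $Y:=X\times\mathbb R_+$. Let $\Gamma(Y)$ be the space of locally finite subsets $\gamma$ of $Y$, identified with the Radon measures $\sum_{y\in\gamma}\delta_y$ and equipped with the trace of $\mathcal B(\mathbb M(Y))$, let $\Gamma_0(Y)\subset\Gamma(Y)$ be the subspace of finite subsets, and $\Gamma^{(n)}(Y)$ the set of $n$-point subsets. Let $\mathcal E:\mathbb K(X)\to\Gamma(Y)$, $\mathcal E(\sum_i s_i\delta_{x_i}):=\{(x_i,s_i)\}$. The correlation measure of a probability measure $\nu$ on $\Gamma(Y)$ is the measure $\rho$ on $\Gamma_0(Y)$ such that $$\int_{\Gamma(Y)}\sum_{\lambda\subset\gamma,\ |\lambda|<\infty}G(\lambda)\,d\nu(\gamma)=\int_{\Gamma_0(Y)}G\,d\rho$$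 for all measurable $G:\Gamma_0(Y)\to[0,\infty]$. Write $\mathcal B_c(X)$ for the Borel sets of $X$ with compact closure, $X^{(n)}_{\widehat0}$ for the set of points of $X^n$ with pairwise different coordinates, $\mathcal B_c(X^{(n)}_{\widehat 0})$ for its Borel subsets with compact closure in $X^n$, and $\mathscr V_n:=\{(x_1,s_1,\dots,x_n,s_n)\in Y^n: (x_1,\dots,x_n)\in X^{(n)}_{\widehat0}\}$. Let $\mu$ be a random discrete measure on $X$, i.e. a probability measure on $\mathbb M(X)$ concentrated on $\mathbb K(X)$, with finite moments: $\int\eta(A)^n\,d\mu(\eta)<\infty$ for all $n$ and $A\in\mathcal B_c(X)$. Let $M^{(n)}$ be its $n$-th moment measure on $X^n$, $M^{(n)}(A_1\times\dots\times A_n)=\int\eta(A_1)\cdots\eta(A_n)\,d\mu(\eta)$. For $i_1,\dots,i_n\ge1$ let $M_{i_1,\dots,i_n}$ be the measure on $X^{(n)}_{\widehat0}$ obtained by restricting $M^{(i_1+\dots+i_n)}$ to the set of all points $$(\underbrace{x_1,\dots,x_1}_{i_1},\dots,\underbrace{x_n,\dots,x_n}_{i_n}),\qquad (x_1,\dots,x_n)\in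 X^{(n)}_{\widehat0},$$ and identifying such a point with $(x_1,\dots,x_n)$. Assume (C1) for each $\Lambda\in\mathcal B_c(X)$ there is a constant $C_\Lambda>0$ with $M^{(n)}(\Lambda^n)\le C_\Lambda^n\,n!$ for all $n\ge1$. Let $\nu$ be the image of $\mu$ under $\mathcal E$. Then: (i) For each $n\ge1$ and $\Delta\in\mathcal B_c(X^{(n)}_{\widehat0})$ there is a unique finite measure $\xi^{(n)}_\Delta$ on $(\mathbb R_+)^n$ with $$\int s_1^{i_1}\cdots s_n^{i_n}\,d\xi^{(n)}_\Delta(s_1,\dots,s_n)=\frac1{n!}M_{i_1+1,\dots,i_n+1}(\Delta)\quad\text{for all integers } i_1,\dots,i_n\ge0.$$ (ii) For each $n\ge1$ there is a unique measure $\xi^{(n)}$ on $\mathscr V_n$ with $$\xi^{(n)}_\Delta(A)=\xi^{(n)}\{(x_1,s_1,\dots,x_n,s_n)\in\mathscr V_n:(x_1,\dots,x_n)\in\Delta,\ (s_1,\dots,s_n)\in A\}$$ for all $\Delta\in\mathcal B_c(X^{(n)}_{\widehat0})$ and all Borel $A\subset(\mathbb R_+)^n$. (iii) The correlation measure $\rho$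 of $\nu$ exists and is unique, and for each $n\ge1$ the measure $d\rho^{(n)}:=(s_1\cdots s_n)^{-1}\,d\xi^{(n)}$ on $\mathscr V_n$ is the restriction of $\rho$ to $\Gamma^{(n)}(Y)$; that is, $\rho^{(n)}$ is invariant under permutations of the $n$ points $(x_j,s_j)$, and its image under $(x_1,s_1,\dots,x_n,s_n)\mapsto\{(x_1,s_1),\dots,(x_n,s_n)\}$ is the restriction of $\rho$ to $\Gamma^{(n)}(Y)$. -/

import Mathlib

open MeasureTheory Set
open scoped ENNReal Nat CompactlySupported

noncomputable section

namespace RandomDiscrete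

/-- The half-line `(0,∞)`. Its usual topology is also the one of the metric `|log (a / b)|`. -/
abbrev Rpos : Type := Set.Ioi (0 : ℝ)

/-! ### Radon measures, vague topology -/

/-- Nonnegative Radon measures on `X`: Borel measures that are finite on compact sets.
(On a locally compact Polish space regularity is automatic.) -/
def RadonMeasure (X : Type*) [TopologicalSpace X] [MeasurableSpace X] : Type _ :=
  {η : Measure X // IsFiniteMeasureOnCompacts η}

/-- The vague topology: the coarsest one for which `η ↦ ∫ f dη` is continuous for every continuous
compactly supported `f : X → ℝ`. -/
instance RadonMeasure.instTopologicalSpace (X : Type*) [TopologicalSpace X] [MeasurableSpace X] :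
    TopologicalSpace (RadonMeasure X) :=
  TopologicalSpace.induced (fun (η : RadonMeasure X) (f : C_c(X, ℝ)) => ∫ x, f x ∂η.1) inferInstance

/-- The Borel σ-algebra of the vague topology. -/
instance RadonMeasure.instMeasurableSpace (X : Type*) [TopologicalSpace X] [MeasurableSpace X] :
    MeasurableSpace (RadonMeasure X) :=
  borel (RadonMeasure X)

/-- The cone `𝕂(X)` of discrete Radon measures `∑ sᵢ δ_{xᵢ}`, with `sᵢ > 0` and at most countably
many distinct atoms `xᵢ`. -/
def discreteCone (X : Type*) [TopologicalSpace X] [MeasurableSpace X] : Set (RadonMeasure X) :=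
  {η | ∃ (S : Set X) (s : X → ℝ), S.Countable ∧ (∀ x ∈ S, 0 < s x) ∧
    η.1 = Measure.sum (fun x : S => ENNReal.ofReal (s x) • Measure.dirac (x : X))}

/-! ### Configurations -/

/-- The configuration space `Γ(Y)`: locally finite subsets of `Y`. -/
def Configuration (Y : Type*) [TopologicalSpace Y] : Type _ :=
  {γ : Set Y // ∀ K : Set Y, IsCompact K → (γ ∩ K).Finite}

/-- The Radon measure `∑_{y ∈ γ} δ_y` identified with the configuration `γ`. -/
def Configuration.toRadon {Y : Type*} [TopologicalSpace Y] [T2Space Y] [MeasurableSpace Y]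
    [OpensMeasurableSpace Y] (γ : Configuration Y) : RadonMeasure Y :=
  ⟨Measure.sum (fun y : γ.1 => Measure.dirac (y : Y)), by
    refine ⟨fun K hK => ?_⟩
    rw [Measure.sum_apply _ hK.measurableSet]
    have hfin : {y : γ.1 | (y : Y) ∈ K}.Finite := by
      refine Set.Finite.of_finite_image (f := Subtype.val) ?_ Subtype.val_injective.injOn
      refine (γ.2 K hK).subset ?_
      rintro _ ⟨y, hy, rfl⟩
      exact ⟨y.2, hy⟩
    rw [tsum_eq_sum (s := hfin.toFinset)]
    · refine ENNReal.sum_lt_top.2 fun y _ => ?_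
      exact measure_lt_top _ _
    · intro y hy
      rw [Measure.dirac_apply' _ hK.measurableSet]
      simpa using hy⟩

/-- The trace on `Γ(Y)` of the Borel σ-algebra of the space of Radon measures on `Y`. -/
instance Configuration.instMeasurableSpace (Y : Type*) [TopologicalSpace Y] [T2Space Y]
    [MeasurableSpace Y] [OpensMeasurableSpace Y] : MeasurableSpace (Configuration Y) :=
  MeasurableSpace.comap Configuration.toRadon inferInstance

/-- The space `Γ₀(Y)` of finite configurations in `Y`. -/
def FiniteConfiguration (Y : Type*) : Type _ := Finset Y

/-- The underlying set of a finite configuration. -/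
def FiniteConfiguration.carrier {Y : Type*} (l : FiniteConfiguration Y) : Set Y :=
  {y | Membership.mem (γ := Finset Y) l y}

/-- The inclusion of `Γ₀(Y)` in `Γ(Y)`. -/
def FiniteConfiguration.toConfiguration {Y : Type*} [TopologicalSpace Y]
    (l : FiniteConfiguration Y) : Configuration Y :=
  ⟨l.carrier, fun K _ => (Finset.finite_toSet (α := Y) l).inter_of_left K⟩

/-- The trace on `Γ₀(Y)` of the σ-algebra of `Γ(Y)`. -/
instance FiniteConfiguration.instMeasurableSpace (Y : Type*) [TopologicalSpace Y] [T2Space Y]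
    [MeasurableSpace Y] [OpensMeasurableSpace Y] : MeasurableSpace (FiniteConfiguration Y) :=
  MeasurableSpace.comap FiniteConfiguration.toConfiguration inferInstance

/-- The set `Γ⁽ⁿ⁾(Y)` of configurations with exactly `n` points. -/
def configurationsOfCard (Y : Type*) (n : ℕ) : Set (FiniteConfiguration Y) :=
  {l | l.carrier.ncard = n}

/-- `ρ` is the correlation measure of the point process `ν` on `Y`: the integral over `γ` of
the sum of `G(λ)` over all finite `λ ⊆ γ` is the integral of `G` against `ρ`. -/
def IsCorrelationMeasure {Y : Type*} [TopologicalSpace Y] [T2Space Y] [MeasurableSpace Y]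
    [OpensMeasurableSpace Y] (ν : Measure (Configuration Y))
    (ρ : Measure (FiniteConfiguration Y)) : Prop :=
  ∀ G : FiniteConfiguration Y → ℝ≥0∞, Measurable G →
    ∫⁻ γ, ∑' l : {l : FiniteConfiguration Y // l.carrier ⊆ γ.1}, G l.1 ∂ν = ∫⁻ l, G l ∂ρ

/-! ### The point process of a random discrete measure -/

section Atoms

variable {X : Type*} [TopologicalSpace X] [T2Space X] [MeasurableSpace X] [OpensMeasurableSpace X]

/-- The set of pairs (atom, mass of the atom) of a Radon measure is locally finite in
`X × (0,∞)`. -/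
theorem atoms_locallyFinite (η : RadonMeasure X) (K : Set (X × Rpos)) (hK : IsCompact K) :
    ({p : X × Rpos | η.1 {p.1} = ENNReal.ofReal p.2} ∩ K).Finite := by
  rcases K.eq_empty_or_nonempty with rfl | hne
  · simp
  obtain ⟨q, -, hq⟩ := hK.exists_isMinOn (f := fun p : X × Rpos => (p.2 : ℝ)) hne (by fun_prop)
  have hq0 : (0 : ℝ) < q.2 := q.2.2
  set K₁ : Set X := Prod.fst '' K
  have hK₁ : IsCompact K₁ := hK.image continuous_fst
  have := η.2
  have : IsFiniteMeasure (η.1.restrict K₁) :=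
    ⟨by rw [Measure.restrict_apply_univ]; exact hK₁.measure_lt_top⟩
  have hfin : {x : X | ENNReal.ofReal q.2 ≤ (η.1.restrict K₁) {x}}.Finite := by
    refine Measure.finite_const_le_meas_of_disjoint_iUnion (η.1.restrict K₁)
      (ENNReal.ofReal_pos.2 hq0) (As := fun x : X => {x}) (fun x => measurableSet_singleton x)
      (fun x y hxy => by simpa using hxy) (measure_ne_top _ _)
  refine Set.Finite.of_finite_image (f := Prod.fst) (hfin.subset ?_) ?_
  · rintro _ ⟨p, ⟨hp, hpK⟩, rfl⟩
    have h1 : p.1 ∈ K₁ := ⟨p, hpK, rfl⟩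
    simp only [mem_ofPred_eq] at hp ⊢
    rw [Measure.restrict_apply (measurableSet_singleton _),
      inter_eq_self_of_subset_left (singleton_subset_iff.2 h1), hp]
    exact ENNReal.ofReal_le_ofReal (hq hpK)
  · rintro ⟨x, s⟩ ⟨hp, -⟩ ⟨y, t⟩ ⟨hr, -⟩ (rfl : x = y)
    have h : ENNReal.ofReal s = ENNReal.ofReal t := hp.symm.trans hr
    rw [ENNReal.ofReal_eq_ofReal_iff s.2.le t.2.le] at h
    rw [Subtype.ext h]

/-- The map `ℰ`, sending `∑ sᵢ δ_{xᵢ} ∈ 𝕂(X)` (distinct `xᵢ`, `sᵢ > 0`) to `{(xᵢ, sᵢ)}`. Written as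
the set of pairs (atom, mass of the atom), it makes sense on all Radon measures. -/
def atomMap (η : RadonMeasure X) : Configuration (X × Rpos) :=
  ⟨{p | η.1 {p.1} = ENNReal.ofReal p.2}, atoms_locallyFinite η⟩

end Atoms

/-! ### Moments -/

section Moments

variable {X : Type*} [TopologicalSpace X] [MeasurableSpace X]

/-- All moments are finite: `𝔼[η(A)ⁿ] < ∞` for every relatively compact Borel set `A`. -/
def HasFiniteMoments (μ : Measure (RadonMeasure X)) : Prop :=
  ∀ (n : ℕ) (A : Set X), MeasurableSet A → IsCompact (closure A) →
    ∫⁻ η, (η.1 A) ^ n ∂μ < ∞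

/-- The moment measure `M⁽ⁿ⁾(B) = 𝔼[η^{⊗n}(B)]` on `Xⁿ`; in particular
`M⁽ⁿ⁾(A₁ × ⋯ × Aₙ) = 𝔼[η(A₁) ⋯ η(Aₙ)]`. -/
def momentMeasure (μ : Measure (RadonMeasure X)) (n : ℕ) : Measure (Fin n → X) :=
  μ.bind (fun η => Measure.pi (fun _ : Fin n => η.1))

/-- Condition (C1): for every relatively compact Borel set `Λ` there is `C > 0` such that
`M⁽ⁿ⁾(Λⁿ) ≤ Cⁿ n!` for all `n ≥ 1`. -/
def ConditionC1 (μ : Measure (RadonMeasure X)) : Prop :=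
  ∀ Λ : Set X, MeasurableSet Λ → IsCompact (closure Λ) →
    ∃ C : ℝ, 0 < C ∧ ∀ n : ℕ, 1 ≤ n →
      momentMeasure μ n (Set.univ.pi fun _ => Λ) ≤ ENNReal.ofReal (C ^ n * n !)

end Moments

/-- The set of `n`-tuples in `X` with pairwise different coordinates. -/
abbrev OffDiag (X : Type*) (n : ℕ) : Type _ := {x : Fin n → X // Function.Injective x}

/-- Borel subsets of `OffDiag X n` with compact closure in `Xⁿ`. -/
def IsBoundedBorel {X : Type*} [TopologicalSpace X] [MeasurableSpace X] {n : ℕ}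
    (Δ : Set (OffDiag X n)) : Prop :=
  MeasurableSet Δ ∧ IsCompact (closure (Subtype.val '' Δ))

/-- The number of the block containing a given index, when `{1, …, i₁ + ⋯ + iₙ}` is cut into
consecutive blocks of lengths `i₁, …, iₙ`. -/
def blockIndex {n : ℕ} (i : Fin n → ℕ) (a : Fin (∑ j, i j)) : Fin n :=
  (finSigmaFinEquiv.symm a).1

/-- The tuples of length `i₁ + ⋯ + iₙ` whose coordinates agree precisely when their indices lie in
the same block. -/
abbrev BlockDiag (X : Type*) {n : ℕ} (i : Fin n → ℕ) : Type _ :=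
  {x : Fin (∑ j, i j) → X // ∀ a b, x a = x b ↔ blockIndex i a = blockIndex i b}

/-- The bijection from `BlockDiag X i` to `OffDiag X n` keeping one (the first) coordinate of each
block. -/
def blockCollapse {X : Type*} {n : ℕ} (i : Fin n → ℕ) (hi : ∀ j, 0 < i j)
    (x : BlockDiag X i) : OffDiag X n :=
  ⟨fun j => x.1 (finSigmaFinEquiv ⟨j, ⟨0, hi j⟩⟩), fun j k h => by
    simpa [blockIndex] using (x.2 _ _).1 h⟩

/-- The measure `m_{i₁,…,iₙ}` on `OffDiag X n`: the restriction of `m` to `BlockDiag X i`, pushed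
forward under `blockCollapse`. -/
def blockMeasure {X : Type*} [MeasurableSpace X] {n : ℕ} (i : Fin n → ℕ) (hi : ∀ j, 0 < i j)
    (m : Measure (Fin (∑ j, i j) → X)) : Measure (OffDiag X n) :=
  (m.comap (Subtype.val : BlockDiag X i → (Fin (∑ j, i j) → X))).map (blockCollapse i hi)

/-- The set `𝒱ₙ` of tuples `((x₁,s₁),…,(xₙ,sₙ))` in `X × (0,∞)` with pairwise different `xⱼ`. -/
abbrev MarkedTuple (X : Type*) (n : ℕ) : Type _ :=
  {v : Fin n → X × Rpos // Function.Injective fun j => (v j).1}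

namespace MarkedTuple

variable {X : Type*} {n : ℕ}

/-- `(x₁,…,xₙ)`. -/
def points (v : MarkedTuple X n) : OffDiag X n := ⟨fun j => (v.1 j).1, v.2⟩

/-- `(s₁,…,sₙ)`. -/
def marks (v : MarkedTuple X n) : Fin n → Rpos := fun j => (v.1 j).2

/-- Permutation of the coordinates. -/
def perm (σ : Equiv.Perm (Fin n)) (v : MarkedTuple X n) : MarkedTuple X n :=
  ⟨v.1 ∘ σ, v.2.comp σ.injective⟩

/-- The `n`-point configuration `{(x₁,s₁),…,(xₙ,sₙ)}`. -/
def toFiniteConfiguration (v : MarkedTuple X n) : FiniteConfiguration (X × Rpos) :=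
  (Set.finite_range v.1).toFinset

end MarkedTuple

section Main

variable {X : Type*} [TopologicalSpace X] [MeasurableSpace X]

/-- `ζ` is a finite measure on `(0,∞)ⁿ` with moments
`∫ s₁^{i₁} ⋯ sₙ^{iₙ} dζ = M_{i₁+1,…,iₙ+1}(Δ) / n!` for all `i₁, …, iₙ ≥ 0`. -/
def SolvesMomentProblem (μ : Measure (RadonMeasure X)) {n : ℕ} (Δ : Set (OffDiag X n))
    (ζ : Measure (Fin n → Rpos)) : Prop :=
  IsFiniteMeasure ζ ∧ ∀ i : Fin n → ℕ,
    ∫⁻ s, ENNReal.ofReal (∏ j, (s j : ℝ) ^ i j) ∂ζ =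
      blockMeasure (fun j => i j + 1) (fun j => Nat.succ_pos (i j))
        (momentMeasure μ (∑ j, (i j + 1))) Δ / (n ! : ℝ≥0∞)

/-- `ξ` is a measure on `𝒱ₙ` which glues the solutions of the moment problems:
`ζ(A) = ξ{(x₁,…,xₙ) ∈ Δ, (s₁,…,sₙ) ∈ A}` for the solution `ζ` belonging to `Δ`. -/
def GluesMomentSolutions (μ : Measure (RadonMeasure X)) {n : ℕ}
    (ξ : Measure (MarkedTuple X n)) : Prop :=
  ∀ Δ : Set (OffDiag X n), IsBoundedBorel Δ → ∀ ζ : Measure (Fin n → Rpos),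
    SolvesMomentProblem μ Δ ζ → ∀ A : Set (Fin n → Rpos), MeasurableSet A →
      ζ A = ξ {v | v.points ∈ Δ ∧ v.marks ∈ A}

/-- The measure `(s₁ ⋯ sₙ)⁻¹ dξ` on `𝒱ₙ`. -/
def divideByMarks {n : ℕ} (ξ : Measure (MarkedTuple X n)) : Measure (MarkedTuple X n) :=
  ξ.withDensity fun v => ENNReal.ofReal (∏ j, (v.marks j : ℝ))⁻¹

end Main

end RandomDiscrete

end

/-! The measures in the theorem need not be built from their moments: the point process supplies
them. For a discrete `η`, counting the `n`-tuples of distinct points of `atomMap η` gives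
`tupleMeasure n η`; averaging over `μ` and dividing by `n!` gives `factorialMeasure μ n`, and
weighting this by `s₁⋯sₙ` gives `gluedMeasure μ n`. This is the candidate for `ξ⁽ⁿ⁾`, and its mark
distributions over bounded sets `Δ` are the candidates for the solutions of the moment problems.

The moment identity is a computation with atoms. A point of `X^(i₁+⋯+iₙ)` that repeats `xⱼ` exactly
`iⱼ` times has `η`-power mass `∏ sⱼ^iⱼ`, so the power of `η` restricted to a block diagonal is a sum
over tuples of atoms (`pi_blockSet`). The weight `s₁⋯sₙ` accounts for the shift from `iⱼ` to `iⱼ +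
1`.

Uniqueness of the solutions comes from (C1): moments of order `k` are at most `A Bᵏ k!`, hence the
marks have exponential moments near zero. Every linear form of the marks then has a complex moment
generating function that is analytic in a vertical strip and fixed by its moments; on the imaginary
axis it is the characteristic function (`HasMomentGrowth.ext`). Uniqueness of `ξ⁽ⁿ⁾` is a π-system
argument on rectangles.

The correlation measure is the average of the counting measures on finite subconfigurations. An
`n`-point configuration has `n!` enumerations, which cancels the factor `1/n!` and identifies it
with the image of `factorialMeasure μ n`. The remaining work is measurability of these random
measures for the vague Borel σ-algebra. -/

noncomputable section

namespace RandomDiscrete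

open Filter Topology

set_option linter.unusedSectionVars false

/-! ### Borel structure of the vague topology. -/

section Vague

variable {Z : Type*} [TopologicalSpace Z]

instance Rpos.instLocallyCompactSpace : LocallyCompactSpace Rpos :=
  isOpen_Ioi.locallyCompactSpace

instance RadonMeasure.instBorelSpace [MeasurableSpace Z] : BorelSpace (RadonMeasure Z) := ⟨rfl⟩

instance RadonMeasure.instIsFiniteMeasureOnCompacts [MeasurableSpace Z] (η : RadonMeasure Z) :
    IsFiniteMeasureOnCompacts η.1 := η.2

theorem RadonMeasure.continuous_integral [MeasurableSpace Z] (f : C_c(Z, ℝ)) :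
    Continuous fun η : RadonMeasure Z => ∫ x, f x ∂η.1 :=
  (continuous_apply f).comp (continuous_induced_dom
    (f := fun (η : RadonMeasure Z) (f : C_c(Z, ℝ)) => ∫ x, f x ∂η.1))

variable [T2Space Z] [LocallyCompactSpace Z] [SecondCountableTopology Z]

theorem exists_cutoff {K : Set Z} (hK : IsCompact K) :
    ∃ χ : C_c(Z, ℝ), (∀ z ∈ K, χ z = 1) ∧ ∀ z, χ z ∈ Icc (0 : ℝ) 1 := by
  obtain ⟨f, hf1, hf2, -, hf3⟩ :=
    exists_continuousMap_one_of_isCompact_subset_isOpen hK isOpen_univ (subset_univ K)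
  exact ⟨⟨f, hf2⟩, hf1, hf3⟩

/-- Any open set is an increasing union of compact sets. -/
theorem exists_compact_monotone_iUnion_eq {U : Set Z} (hU : IsOpen U) :
    ∃ F : ℕ → Set Z, (∀ n, IsCompact (F n)) ∧ Monotone F ∧ ⋃ n, F n = U := by
  let _ := TopologicalSpace.metrizableSpaceMetric Z
  obtain ⟨F, hF, -, hFU, hFm⟩ := hU.exists_iUnion_isClosed
  refine ⟨fun n => F n ∩ CompactExhaustion.choice Z n, fun n =>
    ((CompactExhaustion.choice Z).isCompact n).inter_left (hF n), fun m n h =>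
    inter_subset_inter (hFm h) ((CompactExhaustion.choice Z).subset h), ?_⟩
  rw [iUnion_inter_of_monotone hFm (fun m n h => (CompactExhaustion.choice Z).subset h), hFU,
    CompactExhaustion.iUnion_eq, inter_univ]

variable [MeasurableSpace Z] [BorelSpace Z]

/-- Cutoffs squeezed between the indicators of compact sets exhausting `U` and the indicator of `U`
express `η U` as a countable supremum of vaguely continuous functions. The cutoffs need not
increase. -/
theorem RadonMeasure.measurable_measure_of_isOpen {U : Set Z} (hU : IsOpen U) :
    Measurable fun η : RadonMeasure Z => η.1 U := by
  obtain ⟨F, hF, hFm, rfl⟩ := exists_compact_monotone_iUnion_eq hU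
  have hcut : ∀ n, ∃ χ : C_c(Z, ℝ), (∀ z ∈ F n, χ z = 1) ∧ (∀ z ∉ ⋃ n, F n, χ z = 0) ∧
      ∀ z, χ z ∈ Icc (0 : ℝ) 1 := by
    intro n
    obtain ⟨f, hf1, hf2, hf3, hf4⟩ :=
      exists_continuousMap_one_of_isCompact_subset_isOpen (hF n) hU (subset_iUnion F n)
    exact ⟨⟨f, hf2⟩, hf1, fun z hz => image_eq_zero_of_notMem_tsupport fun h => hz (hf3 h), hf4⟩
  choose χ h1 h0 h01 using hcut
  have key : ∀ η : RadonMeasure Z,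
      η.1 (⋃ n, F n) = ⨆ n, ENNReal.ofReal (∫ x, χ n x ∂η.1) := by
    intro η
    have hint : ∀ n, ENNReal.ofReal (∫ x, χ n x ∂η.1) = ∫⁻ x, ENNReal.ofReal (χ n x) ∂η.1 := by
      intro n
      exact ofReal_integral_eq_lintegral_ofReal
        ((χ n).continuous.integrable_of_hasCompactSupport (χ n).hasCompactSupport)
        (Eventually.of_forall fun z => (h01 n z).1)
    simp_rw [hint]
    apply le_antisymm
    · rw [hFm.measure_iUnion]
      refine iSup_mono fun n => ?_
      rw [← lintegral_indicator_one (hF n).measurableSet]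
      refine lintegral_mono fun z => ?_
      by_cases hz : z ∈ F n
      · simp [hz, h1 n z hz]
      · simp [hz]
    · refine iSup_le fun n => ?_
      rw [← lintegral_indicator_one hU.measurableSet]
      refine lintegral_mono fun z => ?_
      by_cases hz : z ∈ ⋃ n, F n
      · rw [indicator_of_mem hz]
        simpa using ENNReal.ofReal_le_ofReal (h01 n z).2
      · rw [indicator_of_notMem hz, h0 n z hz]
        simp
  simp_rw [key]
  exact Measurable.iSup fun n =>
    ENNReal.measurable_ofReal.comp (RadonMeasure.continuous_integral (χ n)).measurable

/-- The interiors of the sets of a compact exhaustion. -/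
def exhaustion (Z : Type*) [TopologicalSpace Z] [LocallyCompactSpace Z]
    [SecondCountableTopology Z] (m : ℕ) : Set Z :=
  interior (CompactExhaustion.choice Z m)

theorem isOpen_exhaustion (m : ℕ) : IsOpen (exhaustion Z m) := isOpen_interior

theorem monotone_exhaustion : Monotone (exhaustion Z) := fun _ _ h =>
  interior_mono ((CompactExhaustion.choice Z).subset h)

theorem iUnion_exhaustion : ⋃ m, exhaustion Z m = univ :=
  eq_univ_of_subset (iUnion_subset fun m => (subset_iUnion (exhaustion Z) (m + 1)).trans' <|
    (CompactExhaustion.choice Z).subset_interior_succ m) (CompactExhaustion.choice Z).iUnion_eq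

theorem RadonMeasure.measure_exhaustion_lt_top (η : RadonMeasure Z) (m : ℕ) :
    η.1 (exhaustion Z m) < ∞ :=
  (measure_mono interior_subset).trans_lt
    ((CompactExhaustion.choice Z).isCompact m).measure_lt_top

/-- Continuity from below. It reduces locally finite measures to their finite restrictions, for
which a generating π-system suffices. -/
theorem measurable_of_restrict_iUnion {Ω W : Type*} [MeasurableSpace Ω] [MeasurableSpace W]
    {κ : Ω → Measure W} {U : ℕ → Set W} (hm : Monotone U)
    (hun : ⋃ m, U m = univ) (h : ∀ m, Measurable fun ω => (κ ω).restrict (U m)) :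
    Measurable κ := by
  refine Measure.measurable_of_measurable_coe _ fun B hB => ?_
  have : ∀ ω, κ ω B = ⨆ m, (κ ω).restrict (U m) B := by
    intro ω
    simp_rw [Measure.restrict_apply hB]
    rw [← Monotone.measure_iUnion (fun m n h => inter_subset_inter_right _ (hm h)), ← inter_iUnion,
      hun, inter_univ]
  simp_rw [this]
  exact Measurable.iSup fun m => Measure.measurable_measure.1 (h m) B hB

theorem RadonMeasure.measurable_val : Measurable fun η : RadonMeasure Z => η.1 := by
  refine measurable_of_restrict_iUnion (U := exhaustion Z)
    monotone_exhaustion iUnion_exhaustion fun m => ?_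
  have : ∀ η : RadonMeasure Z, IsFiniteMeasure (η.1.restrict (exhaustion Z m)) := fun η =>
    ⟨by rw [Measure.restrict_apply_univ]; exact η.measure_exhaustion_lt_top m⟩
  refine Measurable.measure_of_isPiSystem (BorelSpace.measurable_eq (α := Z))
    (isPiSystem_isOpen) (fun U hU => ?_) ?_
  · simp_rw [Measure.restrict_apply (IsOpen.measurableSet hU)]
    exact measurable_measure_of_isOpen (IsOpen.inter hU (isOpen_exhaustion m))
  · simp_rw [Measure.restrict_apply_univ]
    exact measurable_measure_of_isOpen (isOpen_exhaustion m)

theorem RadonMeasure.measurable_measure {B : Set Z} (hB : MeasurableSet B) :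
    Measurable fun η : RadonMeasure Z => η.1 B :=
  Measure.measurable_measure.1 measurable_val B hB

/-- Functions supported in a given compact set are uniformly approximated by a countable family. -/
theorem exists_countable_uniformly_dense {K : Set Z} (hK : IsCompact K) :
    ∃ D : Set C_c(Z, ℝ), D.Countable ∧ ∀ f : C_c(Z, ℝ), tsupport f ⊆ K → ∀ ε > 0,
      ∃ d ∈ D, tsupport d ⊆ K ∧ ∀ z, |f z - d z| < ε := by
  let S : Set C(Z, ℝ) := {f | tsupport f ⊆ K}
  obtain ⟨E, hE, hEd⟩ := TopologicalSpace.exists_countable_dense S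
  let ι : S → C_c(Z, ℝ) := fun f => ⟨f.1, hK.of_isClosed_subset (isClosed_tsupport _) f.2⟩
  -- Density in `S` is for the compact-open topology, which controls the error uniformly on `K`;
  -- outside `K` both functions vanish.
  refine ⟨ι '' E, hE.image _, fun f hf ε hε => ?_⟩
  let f' : S := ⟨f.toContinuousMap, hf⟩
  have hnhds : {g : S | ∀ z ∈ K, dist (f'.1 z) (g.1 z) < ε} ∈ 𝓝 f' := by
    have h1 := (ContinuousMap.tendsto_iff_forall_isCompact_tendstoUniformlyOn.1
      (continuous_subtype_val.tendsto f')) K hK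
    exact Metric.tendstoUniformlyOn_iff.1 h1 ε hε
  obtain ⟨g, hgE, hg⟩ := hEd.inter_nhds_nonempty hnhds
  refine ⟨ι g, mem_image_of_mem _ hgE, g.2, fun z => ?_⟩
  by_cases hz : z ∈ K
  · exact hg z hz
  · have h1 : f z = 0 := image_eq_zero_of_notMem_tsupport fun h => hz (hf h)
    have h2 : ι g z = 0 := image_eq_zero_of_notMem_tsupport fun h => hz (g.2 h)
    simpa [h1, h2] using hε

/-- The vague topology is initial for uncountably many integrals, so its Borel σ-algebra could
exceed the one these integrals generate. Countably many test functions already induce it: dense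
families on the sets of an exhaustion, together with cutoffs that bound the mass there locally. -/
theorem exists_countable_isInducing : ∃ D : Set C_c(Z, ℝ), D.Countable ∧
    IsInducing fun (η : RadonMeasure Z) (d : D) => ∫ x, d.1 x ∂η.1 := by
  have hK := (CompactExhaustion.choice Z).isCompact
  choose D hD hDd using fun m => exists_countable_uniformly_dense (hK m)
  choose χ h1 h01 using fun m => exists_cutoff (hK m)
  refine ⟨(⋃ m, D m) ∪ range χ, (countable_iUnion hD).union (countable_range χ), ⟨?_⟩⟩
  set E := (⋃ m, D m) ∪ range χ
  apply le_antisymm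
  · exact continuous_iff_le_induced.1
      (continuous_pi fun d => RadonMeasure.continuous_integral d.1)
  set t : TopologicalSpace (RadonMeasure Z) :=
    .induced (fun (η : RadonMeasure Z) (d : E) => ∫ x, d.1 x ∂η.1) inferInstance with ht
  have hE : ∀ d ∈ E, Continuous[t, _] fun η : RadonMeasure Z => ∫ x, d x ∂η.1 := fun d hd =>
    (continuous_apply (⟨d, hd⟩ : E)).comp (continuous_induced_dom
      (f := fun (η : RadonMeasure Z) (d : E) => ∫ x, d.1 x ∂η.1))
  refine continuous_iff_le_induced.1 (@continuous_pi _ _ _ t _ _ fun f => ?_)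
  obtain ⟨m, hm⟩ := (CompactExhaustion.choice Z).exists_superset_of_isCompact f.hasCompactSupport
  have hχE : χ m ∈ E := Or.inr ⟨m, rfl⟩
  have hint : ∀ (g : C_c(Z, ℝ)) (η : RadonMeasure Z), Integrable g η.1 := fun g η =>
    g.continuous.integrable_of_hasCompactSupport g.hasCompactSupport
  refine @continuous_iff_continuousAt _ _ t _ _ |>.2 fun η₀ => ?_
  refine @continuousAt_of_locally_uniform_approx_of_continuousAt _ _ t _ _ _ fun u hu => ?_
  obtain ⟨ε, hε, hεu⟩ := Metric.mem_uniformity_dist.1 hu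
  -- On the neighbourhood where the cutoff has integral below `c + 1`, an `ε / (c +
  -- 1)`-approximation of `f` supported in the same compact set has integral within `ε` of that of
  -- `f`.
  set c := ∫ x, χ m x ∂η₀.1 with hc
  have hc0 : 0 ≤ c := integral_nonneg fun z => (h01 m z).1
  have hc1 : 0 < c + 1 := by positivity
  obtain ⟨d, hd, hdK, hfd⟩ := hDd m f hm (ε / (c + 1)) (by positivity)
  refine ⟨{η | ∫ x, χ m x ∂η.1 < c + 1}, ?_, fun η => ∫ x, d x ∂η.1, ?_, fun η hη => hεu ?_⟩
  · have hopen : IsOpen[t] {η | ∫ x, χ m x ∂η.1 < c + 1} :=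
      (hE _ hχE).isOpen_preimage (Iio (c + 1)) isOpen_Iio
    exact @IsOpen.mem_nhds _ t η₀ _ hopen (lt_add_one c)
  · exact (hE d (Or.inl (mem_iUnion.2 ⟨m, hd⟩))).continuousAt
  · rw [dist_eq_norm, ← integral_sub (hint f η) (hint d η)]
    refine (norm_integral_le_of_norm_le ((hint (χ m) η).const_mul (ε / (c + 1)))
      (Eventually.of_forall fun z => ?_)).trans_lt ?_
    · by_cases hz : z ∈ CompactExhaustion.choice Z m
      · simpa [h1 m z hz] using (hfd z).le
      · have e1 : f z = 0 := image_eq_zero_of_notMem_tsupport fun h => hz (hm h)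
        have e2 : d z = 0 := image_eq_zero_of_notMem_tsupport fun h => hz (hdK h)
        rw [e1, e2, sub_zero, norm_zero]
        exact mul_nonneg (by positivity) (h01 m z).1
    · rw [integral_const_mul]
      calc ε / (c + 1) * ∫ x, χ m x ∂η.1 < ε / (c + 1) * (c + 1) := by
            have : ∫ x, χ m x ∂η.1 < c + 1 := hη
            gcongr
        _ = ε := by field_simp

instance RadonMeasure.instSecondCountableTopology : SecondCountableTopology (RadonMeasure Z) := by
  obtain ⟨D, hD, hind⟩ := exists_countable_isInducing (Z := Z)
  have := hD.to_subtype
  exact hind.secondCountableTopology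

/-- A map into the space of Radon measures is measurable as soon as the integrals of continuous
compactly supported functions are. -/
theorem RadonMeasure.measurable_of_integral {Ω : Type*} [MeasurableSpace Ω] {F : Ω → RadonMeasure Z}
    (h : ∀ f : C_c(Z, ℝ), Measurable fun ω => ∫ x, f x ∂(F ω).1) : Measurable F := by
  obtain ⟨D, hD, hind⟩ := exists_countable_isInducing (Z := Z)
  have := hD.to_subtype
  refine measurable_of_isOpen fun U hU => ?_
  obtain ⟨V, hV, rfl⟩ := hind.isOpen_iff.1 hU
  -- The index set `D` is countable, so the Borel σ-algebra of the product is the product σ-algebra.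
  exact (measurable_pi_lambda (fun ω (d : D) => ∫ x, d.1 x ∂(F ω).1) fun d => h d.1) hV.measurableSet

/-- A map into the space of Radon measures is measurable as soon as the integrals of nonnegative
measurable functions are. -/
theorem RadonMeasure.measurable_of_lintegral {Ω : Type*} [MeasurableSpace Ω]
    {F : Ω → RadonMeasure Z}
    (h : ∀ f : Z → ℝ≥0∞, Measurable f → Measurable fun ω => ∫⁻ x, f x ∂(F ω).1) :
    Measurable F := by
  refine measurable_of_integral fun f => ?_
  have hf := f.continuous.measurable
  have key : ∀ ω, ∫ x, f x ∂(F ω).1 = (∫⁻ x, ENNReal.ofReal (f x) ∂(F ω).1).toReal -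
      (∫⁻ x, ENNReal.ofReal (-f x) ∂(F ω).1).toReal := fun ω =>
    integral_eq_lintegral_pos_part_sub_lintegral_neg_part
      (f.continuous.integrable_of_hasCompactSupport f.hasCompactSupport)
  simp_rw [key]
  exact (h _ hf.ennreal_ofReal).ennreal_toReal.sub (h _ hf.neg.ennreal_ofReal).ennreal_toReal

end Vague

/-! ### Measurable dependence of integrals on the measure, and measurability of the atom map. -/

section Kernels

variable {Z : Type*} [TopologicalSpace Z] [T2Space Z] [LocallyCompactSpace Z]
  [SecondCountableTopology Z] [MeasurableSpace Z] [BorelSpace Z]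

theorem RadonMeasure.measurable_pi (n : ℕ) :
    Measurable fun η : RadonMeasure Z => Measure.pi fun _ : Fin n => η.1 := by
  refine measurable_of_restrict_iUnion (U := fun m => univ.pi fun _ => exhaustion Z m)
    (fun k m h => pi_mono fun _ _ => monotone_exhaustion h) ?_ fun m => ?_
  · rw [iUnion_univ_pi_of_monotone fun _ => monotone_exhaustion]
    simp [iUnion_exhaustion]
  · simp_rw [Measure.restrict_pi_pi]
    have : ∀ η : RadonMeasure Z, IsFiniteMeasure (η.1.restrict (exhaustion Z m)) := fun η =>
      ⟨by rw [Measure.restrict_apply_univ]; exact η.measure_exhaustion_lt_top m⟩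
    have hU : MeasurableSet (exhaustion Z m) := (isOpen_exhaustion m).measurableSet
    refine Measurable.measure_of_isPiSystem generateFrom_pi.symm isPiSystem_pi ?_ ?_
    · rintro _ ⟨B, hB, rfl⟩
      simp_rw [Measure.pi_pi]
      refine Finset.measurable_prod _ fun i _ => ?_
      simp_rw [Measure.restrict_apply (hB i (mem_univ i))]
      exact measurable_measure ((hB i (mem_univ i)).inter hU)
    · simp_rw [Measure.pi_univ, Measure.restrict_apply_univ]
      exact Finset.measurable_prod _ fun i _ => measurable_measure hU

variable {Ω : Type*} [MeasurableSpace Ω]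

/-- The restrictions to an exhaustion are finite kernels, for which sections have measurable mass;
then pass to the supremum. -/
theorem RadonMeasure.measurable_measure_prodMk {κ : Ω → RadonMeasure Z} (hκ : Measurable κ)
    {t : Set (Ω × Z)} (ht : MeasurableSet t) :
    Measurable fun ω => (κ ω).1 (Prod.mk ω ⁻¹' t) := by
  have hfin : ∀ (m : ℕ) (ω : Ω), IsFiniteMeasure ((κ ω).1.restrict (exhaustion Z m)) :=
    fun m ω => ⟨by rw [Measure.restrict_apply_univ]; exact (κ ω).measure_exhaustion_lt_top m⟩
  let K : ℕ → ProbabilityTheory.Kernel Ω Z := fun m =>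
    ⟨fun ω => (κ ω).1.restrict (exhaustion Z m),
      Measure.measurable_of_measurable_coe _ fun B hB => by
        simp_rw [Measure.restrict_apply hB]
        exact (measurable_measure (hB.inter (isOpen_exhaustion m).measurableSet)).comp hκ⟩
  have : ∀ ω, (κ ω).1 (Prod.mk ω ⁻¹' t) = ⨆ m, K m ω (Prod.mk ω ⁻¹' t) := by
    intro ω
    change _ = ⨆ m, (κ ω).1.restrict (exhaustion Z m) (Prod.mk ω ⁻¹' t)
    simp_rw [Measure.restrict_apply (measurable_prodMk_left ht)]
    rw [← Monotone.measure_iUnion (fun m n h => inter_subset_inter_right _ (monotone_exhaustion h)),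
      ← inter_iUnion, iUnion_exhaustion, inter_univ]
  simp_rw [this]
  exact Measurable.iSup fun m =>
    ProbabilityTheory.Kernel.measurable_kernel_prodMk_left_of_finite ht (hfin m)

theorem RadonMeasure.measurable_lintegral_prod {κ : Ω → RadonMeasure Z} (hκ : Measurable κ)
    {g : Ω × Z → ℝ≥0∞} (hg : Measurable g) :
    Measurable fun ω => ∫⁻ x, g (ω, x) ∂(κ ω).1 := by
  refine Measurable.ennreal_induction
    (motive := fun g => Measurable fun ω => ∫⁻ x, g (ω, x) ∂(κ ω).1) ?_ ?_ ?_ hg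
  · intro c s hs
    have : ∀ ω, ∫⁻ x, s.indicator (fun _ => c) (ω, x) ∂(κ ω).1 =
        c * (κ ω).1 (Prod.mk ω ⁻¹' s) := fun ω =>
      lintegral_indicator_const_comp measurable_prodMk_left hs c
    simp_rw [this]
    exact (measurable_measure_prodMk hκ hs).const_mul c
  · intro f g _ hf hg ihf ihg
    have : ∀ ω, ∫⁻ x, (f + g) (ω, x) ∂(κ ω).1 =
        ∫⁻ x, f (ω, x) ∂(κ ω).1 + ∫⁻ x, g (ω, x) ∂(κ ω).1 := fun ω =>
      lintegral_add_left (hf.comp measurable_prodMk_left) _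
    simp_rw [this]
    exact ihf.add ihg
  · intro f hf hm ih
    have : ∀ ω, ∫⁻ x, ⨆ n, f n (ω, x) ∂(κ ω).1 = ⨆ n, ∫⁻ x, f n (ω, x) ∂(κ ω).1 := fun ω =>
      lintegral_iSup (fun n => (hf n).comp measurable_prodMk_left) fun m n h x => hm h (ω, x)
    simp_rw [this]
    exact Measurable.iSup ih

theorem RadonMeasure.measurable_measure_singleton :
    Measurable fun p : RadonMeasure Z × Z => p.1.1 {p.2} := by
  have ht : MeasurableSet {q : (RadonMeasure Z × Z) × Z | q.2 = q.1.2} :=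
    measurableSet_eq_fun measurable_snd measurable_fst.snd
  exact measurable_measure_prodMk measurable_fst ht

/-- The mass of an atom, as a positive real number; it is `1` where the mass is zero or infinite. -/
def massToRpos (a : ℝ≥0∞) : Rpos :=
  ⟨if 0 < a.toReal then a.toReal else 1, by
    by_cases h : 0 < a.toReal <;> simp [h]⟩

theorem measurable_massToRpos : Measurable massToRpos :=
  (Measurable.ite (measurableSet_lt measurable_const ENNReal.measurable_toReal)
    ENNReal.measurable_toReal measurable_const).subtype_mk

theorem RadonMeasure.measure_singleton_ne_top (η : RadonMeasure Z) (x : Z) : η.1 {x} ≠ ∞ :=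
  isCompact_singleton.measure_lt_top.ne

theorem RadonMeasure.ofReal_massToRpos (η : RadonMeasure Z) {x : Z} (h : η.1 {x} ≠ 0) :
    ENNReal.ofReal (massToRpos (η.1 {x})) = η.1 {x} := by
  have := ENNReal.toReal_pos h (η.measure_singleton_ne_top x)
  simp [massToRpos, this, ENNReal.ofReal_toReal (η.measure_singleton_ne_top x)]

theorem mem_atomMap (η : RadonMeasure Z) (p : Z × Rpos) :
    p ∈ (atomMap η).1 ↔ η.1 {p.1} = ENNReal.ofReal p.2 := Iff.rfl

theorem measure_singleton_ne_zero_of_mem_atomMap {η : RadonMeasure Z} {p : Z × Rpos}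
    (h : p ∈ (atomMap η).1) : η.1 {p.1} ≠ 0 := by
  rw [(mem_atomMap η p).1 h]
  exact (ENNReal.ofReal_pos.2 p.2.2).ne'

theorem eq_of_mem_atomMap {η : RadonMeasure Z} {p q : Z × Rpos}
    (hp : p ∈ (atomMap η).1) (hq : q ∈ (atomMap η).1) (h : p.1 = q.1) : p = q := by
  have h2 := (mem_atomMap η p).1 hp
  rw [h, (mem_atomMap η q).1 hq, ENNReal.ofReal_eq_ofReal_iff q.2.2.le p.2.2.le] at h2
  exact Prod.ext h (Subtype.ext h2.symm)

/-- The atoms of `η` correspond to the points of `atomMap η`. -/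
def atomEquiv (η : RadonMeasure Z) : {x : Z | η.1 {x} ≠ 0} ≃ (atomMap η).1 where
  toFun x := ⟨(x.1, massToRpos (η.1 {x.1})), (η.ofReal_massToRpos x.2).symm⟩
  invFun p := ⟨p.1.1, measure_singleton_ne_zero_of_mem_atomMap p.2⟩
  left_inv _ := rfl
  right_inv p := Subtype.ext (eq_of_mem_atomMap (Subtype.property _) p.2 rfl)

theorem RadonMeasure.countable_atoms (η : RadonMeasure Z) : {x : Z | η.1 {x} ≠ 0}.Countable := by
  have := Measure.countable_meas_pos_of_disjoint_iUnion (μ := η.1) (As := fun x : Z => {x})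
    (fun x => measurableSet_singleton x) (fun x y hxy => by simpa using hxy)
  simpa [pos_iff_ne_zero] using this

theorem lintegral_toRadon {Y : Type*} [TopologicalSpace Y] [T2Space Y] [MeasurableSpace Y]
    [OpensMeasurableSpace Y] (γ : Configuration Y) {f : Y → ℝ≥0∞} (hf : Measurable f) :
    ∫⁻ y, f y ∂γ.toRadon.1 = ∑' y : γ.1, f y := by
  change ∫⁻ y, f y ∂(Measure.sum fun y : γ.1 => Measure.dirac (y : Y)) = _
  rw [lintegral_sum_measure]
  exact tsum_congr fun y => lintegral_dirac' _ hf

/-- This rewrites a sum over atoms as an integral against `η`, which makes measurability in `η`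
accessible without enumerating atoms: the factor `(η {x})⁻¹` cancels the mass of the atom. The
indicator removes the points of mass zero, where that inverse is `∞`. -/
theorem lintegral_toRadon_atomMap (η : RadonMeasure Z) {f : Z × Rpos → ℝ≥0∞} (hf : Measurable f) :
    ∫⁻ y, f y ∂(atomMap η).toRadon.1 =
      ∫⁻ x, f (x, massToRpos (η.1 {x})) * (η.1 {x})⁻¹ * ({0}ᶜ : Set ℝ≥0∞).indicator 1 (η.1 {x}) ∂η.1 := by
  rw [lintegral_toRadon _ hf, ← (atomEquiv η).tsum_eq]
  have hc := η.countable_atoms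
  have : ∀ x, f (x, massToRpos (η.1 {x})) * (η.1 {x})⁻¹ * ({0}ᶜ : Set ℝ≥0∞).indicator 1 (η.1 {x}) =
      {x : Z | η.1 {x} ≠ 0}.indicator (fun x => f (x, massToRpos (η.1 {x})) * (η.1 {x})⁻¹) x := by
    intro x
    by_cases hx : η.1 {x} = 0 <;> simp [hx]
  simp_rw [this]
  rw [lintegral_indicator hc.measurableSet, lintegral_countable _ hc]
  refine tsum_congr fun x => ?_
  rw [mul_assoc, ENNReal.inv_mul_cancel x.2 (η.measure_singleton_ne_top x), mul_one]
  rfl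

theorem measurable_atomMap : Measurable (atomMap : RadonMeasure Z → Configuration (Z × Rpos)) := by
  refine measurable_comap_iff.2 (RadonMeasure.measurable_of_lintegral fun f hf => ?_)
  simp_rw [Function.comp_apply, lintegral_toRadon_atomMap _ hf]
  have hm := RadonMeasure.measurable_measure_singleton (Z := Z)
  refine RadonMeasure.measurable_lintegral_prod (κ := id) measurable_id
    (g := fun p => f (p.2, massToRpos (p.1.1 {p.2})) * (p.1.1 {p.2})⁻¹ *
      ({0}ᶜ : Set ℝ≥0∞).indicator 1 (p.1.1 {p.2})) ?_
  refine ((hf.comp (measurable_snd.prodMk (measurable_massToRpos.comp hm))).mul hm.inv).mul ?_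
  exact (measurable_one.indicator (measurableSet_singleton 0).compl).comp hm

end Kernels

/-- Integration against a power of a measure that is carried by a countable set. -/
theorem lintegral_pi_of_countable {Z : Type*} [MeasurableSpace Z] [MeasurableSingletonClass Z]
    (m : Measure Z) [SigmaFinite m] {S : Set Z} (hS : S.Countable) (hm : m Sᶜ = 0) {n : ℕ}
    (g : (Fin n → Z) → ℝ≥0∞) :
    ∫⁻ v, g v ∂(Measure.pi fun _ : Fin n => m) = ∑' v : Fin n → Z, g v * ∏ j, m {v j} := by
  have hT : (univ.pi fun _ : Fin n => S).Countable := Set.countable_univ_pi fun _ => hS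
  have hae : ∀ᵐ v ∂(Measure.pi fun _ : Fin n => m), v ∈ univ.pi fun _ : Fin n => S := by
    simp only [Set.mem_pi, mem_univ, true_imp_iff]
    refine ae_all_iff.2 fun j => ?_
    exact Measure.pi_eval_preimage_null (fun _ : Fin n => m) (i := j) hm
  rw [← Measure.restrict_eq_self_of_ae_mem hae, lintegral_countable _ hT]
  simp_rw [Measure.pi_singleton]
  refine tsum_subtype_eq_of_support_subset (f := fun v : Fin n → Z => g v * ∏ j, m {v j}) ?_
  intro v hv j _
  by_contra hj
  refine hv ?_
  have : m {v j} = 0 := measure_mono_null (singleton_subset_iff.2 hj) hm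
  change g v * ∏ j, m {v j} = 0
  rw [Finset.prod_eq_zero (f := fun j => m {v j}) (Finset.mem_univ j) this, mul_zero]

/-! ### Finite subconfigurations and the correlation measure. -/

section Configurations

variable {Y : Type*} [TopologicalSpace Y] [T2Space Y] [LocallyCompactSpace Y]
  [SecondCountableTopology Y] [MeasurableSpace Y] [BorelSpace Y]

theorem Configuration.countable (γ : Configuration Y) : γ.1.Countable := by
  have : γ.1 = ⋃ m, γ.1 ∩ CompactExhaustion.choice Y m := by
    rw [← inter_iUnion, CompactExhaustion.iUnion_eq, inter_univ]
  rw [this]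
  exact countable_iUnion fun m => (γ.2 _ ((CompactExhaustion.choice Y).isCompact m)).countable

theorem Configuration.toRadon_apply (γ : Configuration Y) {B : Set Y} (hB : MeasurableSet B) :
    γ.toRadon.1 B = ∑' y : γ.1, B.indicator 1 (y : Y) := by
  rw [← lintegral_indicator_one hB, lintegral_toRadon γ (measurable_one.indicator hB)]

theorem Configuration.toRadon_singleton (γ : Configuration Y) (y : Y) :
    γ.toRadon.1 {y} = γ.1.indicator 1 y := by
  classical
  rw [γ.toRadon_apply (measurableSet_singleton y), tsum_subtype γ.1 (({y} : Set Y).indicator 1),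
    tsum_eq_single y]
  · simp [indicator_apply]
  · intro z hz
    simp [hz]

/-- The point masses of `γ` are all `1`, so its `n`-th power is the counting measure on tuples from
`γ`, repetitions included. -/
theorem lintegral_pi_toRadon (γ : Configuration Y) {n : ℕ} (g : (Fin n → Y) → ℝ≥0∞) :
    ∫⁻ v, g v ∂(Measure.pi fun _ : Fin n => γ.toRadon.1) =
      ∑' v : {v : Fin n → Y | ∀ j, v j ∈ γ.1}, g v := by
  classical
  have hc : γ.toRadon.1 γ.1ᶜ = 0 := by
    rw [γ.toRadon_apply γ.countable.measurableSet.compl]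
    simp
  rw [lintegral_pi_of_countable _ γ.countable hc, tsum_subtype]
  refine tsum_congr fun v => ?_
  simp_rw [γ.toRadon_singleton]
  by_cases h : ∀ j, v j ∈ γ.1
  · simp [h]
  · rw [indicator_of_notMem (s := {v : Fin n → Y | ∀ j, v j ∈ γ.1}) h]
    push Not at h
    obtain ⟨j, hj⟩ := h
    rw [Finset.prod_eq_zero (Finset.mem_univ j) (indicator_of_notMem hj _), mul_zero]

/-- The finite configuration of the values of a tuple. -/
def tupleConfiguration {Y : Type*} {n : ℕ} (v : Fin n → Y) : FiniteConfiguration Y :=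
  (Set.finite_range v).toFinset

theorem carrier_tupleConfiguration {Y : Type*} {n : ℕ} (v : Fin n → Y) :
    (tupleConfiguration v).carrier = range v := by
  ext y
  exact Set.Finite.mem_toFinset _

theorem FiniteConfiguration.ext_carrier {Y : Type*} {k l : FiniteConfiguration Y}
    (h : k.carrier = l.carrier) : k = l :=
  Finset.ext fun y => Set.ext_iff.1 h y

theorem FiniteConfiguration.finite_carrier {Y : Type*} (l : FiniteConfiguration Y) :
    l.carrier.Finite :=
  Finset.finite_toSet (α := Y) l

theorem carrier_eq_range {Y : Type*} {n : ℕ} {v : Fin n → Y} {l : FiniteConfiguration Y}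
    (h : tupleConfiguration v = l) : l.carrier = range v :=
  h ▸ carrier_tupleConfiguration v

/-- Enumerations of a finite configuration. -/
def enumerationEquiv {Y : Type*} (γ : Set Y) (n : ℕ) (l : FiniteConfiguration Y)
    (hl : l.carrier ⊆ γ) :
    {v : {v : Fin n → Y | Function.Injective v ∧ ∀ j, v j ∈ γ} // tupleConfiguration v.1 = l} ≃
      (Fin n ≃ l.carrier) where
  toFun v := Equiv.ofBijective
    (fun j => ⟨v.1.1 j, (carrier_eq_range v.2).symm ▸ mem_range_self j⟩)
    ⟨fun j k h => v.1.2.1 (congrArg Subtype.val h), fun y => by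
      have hy : y.1 ∈ range v.1.1 := carrier_eq_range v.2 ▸ y.2
      obtain ⟨j, hj⟩ := hy
      exact ⟨j, Subtype.ext hj⟩⟩
  invFun e := ⟨⟨fun j => e j, Subtype.val_injective.comp e.injective, fun j => hl (e j).2⟩, by
    refine FiniteConfiguration.ext_carrier ?_
    rw [carrier_tupleConfiguration]
    exact (EquivLike.range_comp Subtype.val e).trans Subtype.range_coe⟩
  left_inv _ := rfl
  right_inv _ := by
    ext
    rfl

/-- Group the tuples by their set of values: the fibre over an `n`-point set consists of its `n!`
enumerations, and every other fibre is empty. -/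
theorem tsum_tupleConfiguration {Y : Type*} (γ : Set Y) (n : ℕ)
    (G : FiniteConfiguration Y → ℝ≥0∞) :
    ∑' v : {v : Fin n → Y | Function.Injective v ∧ ∀ j, v j ∈ γ}, G (tupleConfiguration v.1) =
      n ! * ∑' l : {l : FiniteConfiguration Y // l.carrier ⊆ γ},
        (configurationsOfCard Y n).indicator G l.1 := by
  classical
  let p : {v : Fin n → Y | Function.Injective v ∧ ∀ j, v j ∈ γ} →
      {l : FiniteConfiguration Y // l.carrier ⊆ γ} := fun v =>
    ⟨tupleConfiguration v.1, by
      rw [carrier_tupleConfiguration]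
      rintro _ ⟨j, rfl⟩
      exact v.2.2 j⟩
  rw [← (Equiv.sigmaFiberEquiv p).tsum_eq, ENNReal.tsum_sigma', ← ENNReal.tsum_mul_left]
  refine tsum_congr fun l => ?_
  have h1 : ∀ v : {v // p v = l},
      G (tupleConfiguration ((Equiv.sigmaFiberEquiv p) ⟨l, v⟩).1) = G l.1 := fun v =>
    congrArg (fun l => G l.1) v.2
  simp_rw [h1]
  have e : {v // p v = l} ≃ (Fin n ≃ l.1.carrier) :=
    (Equiv.subtypeEquivRight fun v => Subtype.ext_iff).trans (enumerationEquiv γ n l.1 l.2)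
  have := l.1.finite_carrier.to_subtype
  rw [ENNReal.tsum_const, ENat.card_congr e, ENat.card_eq_coe_natCard]
  by_cases hl : l.1 ∈ configurationsOfCard Y n
  · rw [indicator_of_mem hl]
    have hcard : Nat.card l.1.carrier = n := hl
    let _ : Fintype l.1.carrier := Fintype.ofFinite _
    rw [Nat.card_eq_fintype_card, Fintype.card_equiv
      (Fintype.equivOfCardEq 
      ((Fintype.card_fin n).trans (hcard.symm.trans Nat.card_eq_fintype_card)))]
    simp
  · have : IsEmpty (Fin n ≃ l.1.carrier) :=
      ⟨fun e => hl ((Nat.card_congr e).symm.trans (Nat.card_fin n))⟩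
    rw [indicator_of_notMem hl]
    simp

theorem measurable_toRadon : Measurable (Configuration.toRadon (Y := Y)) :=
  comap_measurable _

theorem lintegral_toRadon_toConfiguration (l : FiniteConfiguration Y) {f : Y → ℝ≥0∞}
    (hf : Measurable f) :
    ∫⁻ y, f y ∂l.toConfiguration.toRadon.1 = ∑' y : l.carrier, f y :=
  lintegral_toRadon l.toConfiguration hf

/-- Integrals against the configuration are finite sums over the coordinates. Injectivity matters,
since equal coordinates would merge into one point. -/
theorem measurable_tupleConfiguration (n : ℕ) :
    Measurable fun v : {v : Fin n → Y // Function.Injective v} => tupleConfiguration v.1 := by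
  refine measurable_comap_iff.2 (measurable_comap_iff.2
    (RadonMeasure.measurable_of_lintegral fun f hf => ?_))
  simp_rw [Function.comp_apply, lintegral_toRadon_toConfiguration _ hf]
  have : ∀ v : {v : Fin n → Y // Function.Injective v},
      ∑' y : (tupleConfiguration v.1).carrier, f y = ∑ j, f (v.1 j) := by
    intro v
    rw [carrier_tupleConfiguration, tsum_range f v.2, tsum_fintype]
  simp_rw [this]
  exact Finset.measurable_sum _ fun j _ =>
    hf.comp ((measurable_pi_apply j).comp measurable_subtype_coe)

theorem measurableSet_injective (n : ℕ) :
    MeasurableSet {v : Fin n → Y | Function.Injective v} := by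
  have : {v : Fin n → Y | Function.Injective v} =
      ⋂ (i : Fin n) (j : Fin n) (_ : i ≠ j), {v | v i = v j}ᶜ := by
    ext v
    simp only [mem_ofPred_eq, mem_iInter, mem_compl_iff]
    exact ⟨fun h i j hij e => hij (h e), fun h i j e => by_contra fun hij => h i j hij e⟩
  rw [this]
  exact .iInter fun i => .iInter fun j => .iInter fun _ =>
    (measurableSet_eq_fun (measurable_pi_apply i) (measurable_pi_apply j)).compl

/-- Tuples with pairwise different entries whose finite configuration lies in `B`. -/
def tuplesInto {Y : Type*} (n : ℕ) (B : Set (FiniteConfiguration Y)) : Set (Fin n → Y) :=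
  {v | Function.Injective v ∧ tupleConfiguration v ∈ B}

theorem measurableSet_tuplesInto (n : ℕ) {B : Set (FiniteConfiguration Y)}
    (hB : MeasurableSet B) : MeasurableSet (tuplesInto n B) := by
  have h := (measurableSet_injective (Y := Y) n).subtype_image
    (measurable_tupleConfiguration n hB)
  convert h using 1
  ext v
  simp [tuplesInto, and_comm]

theorem tsum_indicator_card (γ : Configuration Y) (n : ℕ) {B : Set (FiniteConfiguration Y)}
    (hB : MeasurableSet B) :
    ∑' l : {l : FiniteConfiguration Y // l.carrier ⊆ γ.1},
        (configurationsOfCard Y n).indicator (B.indicator 1) l.1 =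
      (n ! : ℝ≥0∞)⁻¹ * Measure.pi (fun _ : Fin n => γ.toRadon.1) (tuplesInto n B) := by
  classical
  have hn : (n ! : ℝ≥0∞) ≠ 0 := by exact_mod_cast n.factorial_ne_zero
  rw [← lintegral_indicator_one (measurableSet_tuplesInto n hB), lintegral_pi_toRadon]
  rw [← one_mul (tsum _), ← ENNReal.inv_mul_cancel hn (ENNReal.natCast_ne_top _), mul_assoc,
    ← tsum_tupleConfiguration, tsum_subtype _ fun v => B.indicator 1 (tupleConfiguration v),
    tsum_subtype]
  congr 1
  refine tsum_congr fun v => ?_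
  simp only [indicator_apply, tuplesInto, mem_ofPred_eq, Pi.one_apply]
  split_ifs <;> tauto

/-- The cardinality is the total mass of the associated Radon measure, which is measurable. -/
theorem measurableSet_configurationsOfCard (n : ℕ) :
    MeasurableSet (configurationsOfCard Y n) := by
  have hm : Measurable fun l : FiniteConfiguration Y => l.toConfiguration.toRadon.1 univ :=
    (RadonMeasure.measurable_measure MeasurableSet.univ).comp
      (measurable_toRadon.comp (comap_measurable FiniteConfiguration.toConfiguration))
  have : configurationsOfCard Y n = {l | l.toConfiguration.toRadon.1 univ = (n : ℝ≥0∞)} := by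
    ext l
    have h : l.toConfiguration.toRadon.1 univ = (l.carrier.ncard : ℝ≥0∞) := by
      rw [← lintegral_one, lintegral_toRadon_toConfiguration _ measurable_const,
        ENNReal.tsum_set_one, ← l.finite_carrier.cast_ncard_eq]
      rfl
    simp only [configurationsOfCard, mem_ofPred_eq, h, Nat.cast_inj]
  rw [this]
  exact hm (measurableSet_singleton _)

/-- The counting measure on the finite subconfigurations of `γ`. -/
def subconfigurationMeasure (γ : Configuration Y) : Measure (FiniteConfiguration Y) :=
  Measure.sum fun l : {l : FiniteConfiguration Y // l.carrier ⊆ γ.1} => Measure.dirac l.1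

theorem lintegral_subconfigurationMeasure (γ : Configuration Y) {G : FiniteConfiguration Y → ℝ≥0∞}
    (hG : Measurable G) : ∫⁻ l, G l ∂subconfigurationMeasure γ =
      ∑' l : {l : FiniteConfiguration Y // l.carrier ⊆ γ.1}, G l.1 := by
  rw [subconfigurationMeasure, lintegral_sum_measure]
  exact tsum_congr fun l => lintegral_dirac' _ hG

theorem subconfigurationMeasure_inter_card (γ : Configuration Y) (n : ℕ)
    {B : Set (FiniteConfiguration Y)} (hB : MeasurableSet B) :
    subconfigurationMeasure γ (B ∩ configurationsOfCard Y n) =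
      (n ! : ℝ≥0∞)⁻¹ * Measure.pi (fun _ : Fin n => γ.toRadon.1) (tuplesInto n B) := by
  have h := hB.inter (measurableSet_configurationsOfCard n)
  rw [← tsum_indicator_card γ n hB, ← lintegral_indicator_one h,
    lintegral_subconfigurationMeasure γ (measurable_one.indicator h)]
  simp_rw [indicator_indicator, inter_comm B]

theorem measurable_pi_toRadon (n : ℕ) :
    Measurable fun γ : Configuration Y => Measure.pi fun _ : Fin n => γ.toRadon.1 :=
  (RadonMeasure.measurable_pi n).comp measurable_toRadon

/-- Split by cardinality: each part is a multiple of the mass that a power of `γ.toRadon` gives to a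
fixed measurable set, and powers depend measurably on `γ`. -/
theorem measurable_subconfigurationMeasure :
    Measurable (subconfigurationMeasure (Y := Y)) := by
  refine Measure.measurable_of_measurable_coe _ fun B hB => ?_
  have : ∀ γ : Configuration Y, subconfigurationMeasure γ B =
      ∑' n : ℕ, (n ! : ℝ≥0∞)⁻¹ * Measure.pi (fun _ : Fin n => γ.toRadon.1) (tuplesInto n B) := by
    intro γ
    simp_rw [← subconfigurationMeasure_inter_card γ _ hB]
    rw [← measure_iUnion, ← inter_iUnion]
    · congr 1
      refine (inter_eq_left.2 fun l _ => ?_).symm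
      exact mem_iUnion.2 ⟨l.carrier.ncard, rfl⟩
    · intro m n hmn
      refine Set.disjoint_left.2 fun l hl hl' => hmn ?_
      exact (Eq.symm hl.2).trans hl'.2
    · exact fun n => hB.inter (measurableSet_configurationsOfCard n)
  simp_rw [this]
  exact Measurable.tsum fun n => (Measure.measurable_measure.1 (measurable_pi_toRadon n) _
    (measurableSet_tuplesInto n hB)).const_mul _

theorem isCorrelationMeasure_bind (ν : Measure (Configuration Y)) :
    IsCorrelationMeasure ν (ν.bind subconfigurationMeasure) := by
  intro G hG
  rw [Measure.lintegral_bind measurable_subconfigurationMeasure.aemeasurable hG.aemeasurable]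
  simp_rw [lintegral_subconfigurationMeasure _ hG]

theorem IsCorrelationMeasure.unique {ν : Measure (Configuration Y)}
    {ρ ρ' : Measure (FiniteConfiguration Y)} (h : IsCorrelationMeasure ν ρ)
    (h' : IsCorrelationMeasure ν ρ') : ρ' = ρ := by
  ext B hB
  rw [← lintegral_indicator_one hB, ← lintegral_indicator_one hB,
    ← h _ (measurable_one.indicator hB), ← h' _ (measurable_one.indicator hB)]

end Configurations

/-! ### Determinacy of the moment problem -/

section Determinacy

open ProbabilityTheory

/-- A real function whose exponential is integrable near zero has its complex moment generating
function determined on the imaginary axis by its moments. -/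
theorem complexMGF_I_eq_of_moments {Ω : Type*} [MeasurableSpace Ω] {P Q : Measure Ω} {f : Ω → ℝ}
    {r : ℝ} (hr : 0 < r) (hP : ∀ u ∈ Ioo (-r) r, Integrable (fun ω => Real.exp (u * f ω)) P)
    (hQ : ∀ u ∈ Ioo (-r) r, Integrable (fun ω => Real.exp (u * f ω)) Q)
    (hPQ : ∀ k : ℕ, ∫ ω, f ω ^ k ∂P = ∫ ω, f ω ^ k ∂Q) :
    complexMGF f P Complex.I = complexMGF f Q Complex.I := by
  -- Integrability on the real interval gives analyticity on the whole vertical strip above it,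
  -- which contains both `0` and `i`.
  have hint : ∀ R : Measure Ω, (∀ u ∈ Ioo (-r) r, Integrable (fun ω => Real.exp (u * f ω)) R) →
      Ioo (-r) r ⊆ interior (integrableExpSet f R) := fun R hR =>
    interior_maximal hR isOpen_Ioo
  let U : Set ℂ := Complex.re ⁻¹' Ioo (-r) r
  have h0 : (0 : ℂ) ∈ U := by simp [U, hr]
  have hI : Complex.I ∈ U := by simp [U, hr]
  have hconv : Convex ℝ U := (convex_Ioo (-r) r).linear_preimage Complex.reLm
  have han : ∀ R : Measure Ω, (∀ u ∈ Ioo (-r) r, Integrable (fun ω => Real.exp (u * f ω)) R) →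
      AnalyticOnNhd ℂ (complexMGF f R) U := fun R hR =>
    analyticOnNhd_complexMGF.mono fun z hz => hint R hR hz
  have hder : ∀ R : Measure Ω, (∀ u ∈ Ioo (-r) r, Integrable (fun ω => Real.exp (u * f ω)) R) →
      ∀ k, iteratedDeriv k (complexMGF f R) 0 = Complex.ofReal (∫ ω, f ω ^ k ∂(R)) := by
    intro R hR k
    rw [iteratedDeriv_complexMGF (hint R hR h0), ← integral_complex_ofReal]
    simp
  -- The Taylor coefficients at `0` are moments, so the two functions agree near `0`; the identity
  -- theorem on the convex strip then carries equality to `i`.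
  have hseries : complexMGF f P =ᶠ[𝓝 0] complexMGF f Q := by
    have e1 := (han P hP 0 h0).hasFPowerSeriesAt
    have e2 := (han Q hQ 0 h0).hasFPowerSeriesAt
    simp_rw [hder P hP] at e1
    simp_rw [hder Q hQ, ← hPQ] at e2
    have h := e1.sub e2
    rw [sub_self] at h
    filter_upwards [h.eventually_eq_zero] with z hz
    exact sub_eq_zero.1 hz
  exact (han P hP).eqOn_of_preconnected_of_eventuallyEq (han Q hQ) hconv.isPreconnected h0
    hseries hI

variable {n : ℕ}

/-- The moments of a measure on `(0,∞)ⁿ`. -/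
def moment (ζ : Measure (Fin n → Rpos)) (i : Fin n → ℕ) : ℝ≥0∞ :=
  ∫⁻ s, ENNReal.ofReal (∏ j, (s j : ℝ) ^ i j) ∂ζ

theorem measurable_coe_apply (j : Fin n) : Measurable fun s : Fin n → Rpos => (s j : ℝ) :=
  measurable_subtype_coe.comp (measurable_pi_apply j)

/-- Powers of sums are expanded over words `p : Fin k → Fin n`, avoiding multinomial coefficients;
counting letters turns a word back into a multi-index. -/
theorem prod_comp_eq_prod_pow {k : ℕ} (p : Fin k → Fin n) (s : Fin n → ℝ) :
    ∏ a, s (p a) = ∏ j, s j ^ (Finset.univ.filter fun a => p a = j).card := by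
  rw [← Finset.prod_fiberwise Finset.univ p]
  refine Finset.prod_congr rfl fun j _ => ?_
  rw [← Finset.prod_const]
  exact Finset.prod_congr rfl fun a ha => by rw [(Finset.mem_filter.1 ha).2]

theorem sum_card_fiber {k : ℕ} (p : Fin k → Fin n) :
    ∑ j, (Finset.univ.filter fun a => p a = j).card = k := by
  rw [← Finset.card_eq_sum_card_fiberwise (fun _ _ => Finset.mem_coe.2 (Finset.mem_univ _)),
    Finset.card_univ, Fintype.card_fin]

/-- The growth condition on moments used for determinacy. -/
def HasMomentGrowth (ζ : Measure (Fin n → Rpos)) (A B : ℝ) : Prop :=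
  ∀ i : Fin n → ℕ, moment ζ i ≤ ENNReal.ofReal (A * B ^ (∑ j, i j) * (∑ j, i j)!)

theorem HasMomentGrowth.lintegral_prod_le {ζ : Measure (Fin n → Rpos)} {A B : ℝ}
    (h : HasMomentGrowth ζ A B) {k : ℕ} (p : Fin k → Fin n) :
    ∫⁻ s, ENNReal.ofReal (∏ a, (s (p a) : ℝ)) ∂ζ ≤ ENNReal.ofReal (A * B ^ k * k !) := by
  have := h fun j => (Finset.univ.filter fun a => p a = j).card
  rw [sum_card_fiber p] at this
  refine le_trans (le_of_eq (lintegral_congr fun s => ?_)) this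
  rw [prod_comp_eq_prod_pow p fun j => (s j : ℝ)]

/-- The expansion has `n ^ k` words of length `k`, each bounded by the same moment bound; this turns
`B` into `n * B`. -/
theorem HasMomentGrowth.lintegral_sum_pow_le {ζ : Measure (Fin n → Rpos)} {A B : ℝ}
    (h : HasMomentGrowth ζ A B) (k : ℕ) :
    ∫⁻ s, ENNReal.ofReal ((∑ j, (s j : ℝ)) ^ k) ∂ζ ≤ ENNReal.ofReal (A * (n * B) ^ k * k !) := by
  have h1 : ∀ s : Fin n → Rpos, ENNReal.ofReal ((∑ j, (s j : ℝ)) ^ k) =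
      ∑ p : Fin k → Fin n, ENNReal.ofReal (∏ a, (s (p a) : ℝ)) := by
    intro s
    rw [Fintype.sum_pow, ENNReal.ofReal_sum_of_nonneg]
    exact fun p _ => Finset.prod_nonneg fun a _ => (s (p a)).2.le
  simp_rw [h1]
  rw [lintegral_finsetSum _ fun p _ => (Finset.measurable_prod _ fun a _ =>
    measurable_coe_apply (p a)).ennreal_ofReal]
  refine (Finset.sum_le_sum fun p _ => h.lintegral_prod_le p).trans ?_
  rw [Finset.sum_const, Finset.card_univ, Fintype.card_fun, Fintype.card_fin, Fintype.card_fin,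
    nsmul_eq_mul, ← ENNReal.ofReal_natCast, ← ENNReal.ofReal_mul (by positivity)]
  refine ENNReal.ofReal_le_ofReal (le_of_eq ?_)
  push_cast
  ring

/-- The `k!` in the moment bound cancels the one in the exponential series and leaves a geometric
series of ratio `ε * (n * B)`. -/
theorem HasMomentGrowth.lintegral_exp_lt_top {ζ : Measure (Fin n → Rpos)} {A B : ℝ}
    (hB : 0 ≤ B) (h : HasMomentGrowth ζ A B) {ε : ℝ} (hε : 0 ≤ ε) (hεB : ε * (n * B) < 1) :
    ∫⁻ s, ENNReal.ofReal (Real.exp (ε * ∑ j, (s j : ℝ))) ∂ζ < ∞ := by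
  have h1 : ∀ s : Fin n → Rpos, ENNReal.ofReal (Real.exp (ε * ∑ j, (s j : ℝ))) =
      ∑' k : ℕ, ENNReal.ofReal (ε ^ k / k !) * ENNReal.ofReal ((∑ j, (s j : ℝ)) ^ k) := by
    intro s
    have hs : 0 ≤ ∑ j, (s j : ℝ) := Finset.sum_nonneg fun j _ => (s j).2.le
    have hsum := NormedSpace.expSeries_div_hasSum_exp (ε * ∑ j, (s j : ℝ))
    rw [Real.exp_eq_exp_ℝ, ← hsum.tsum_eq,
      ENNReal.ofReal_tsum_of_nonneg (fun k => by positivity) hsum.summable]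
    refine tsum_congr fun k => ?_
    rw [← ENNReal.ofReal_mul (by positivity)]
    congr 1
    ring
  simp_rw [h1]
  have hm : ∀ k : ℕ, Measurable fun s : Fin n → Rpos =>
      ENNReal.ofReal ((∑ j, (s j : ℝ)) ^ k) := fun k =>
    ((Finset.measurable_sum _ fun j _ => measurable_coe_apply j).pow_const k).ennreal_ofReal
  rw [lintegral_tsum fun k => ((hm k).const_mul _).aemeasurable]
  simp_rw [lintegral_const_mul _ (hm _)]
  have hgeo : Summable fun k : ℕ => A * (ε * (n * B)) ^ k :=
    (summable_geometric_of_lt_one (by positivity) hεB).mul_left A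
  refine lt_of_le_of_lt (ENNReal.tsum_le_tsum fun k => ?_)
    (hgeo.tsum_ofReal_lt_top)
  refine (mul_le_mul_right (h.lintegral_sum_pow_le k) _).trans ?_
  rw [← ENNReal.ofReal_mul (by positivity)]
  refine ENNReal.ofReal_le_ofReal (le_of_eq ?_)
  have : (k ! : ℝ) ≠ 0 := by positivity
  field_simp
  ring

theorem HasMomentGrowth.integrable_prod {ζ : Measure (Fin n → Rpos)} {A B : ℝ}
    (h : HasMomentGrowth ζ A B) {k : ℕ} (p : Fin k → Fin n) :
    Integrable (fun s => ∏ a, (s (p a) : ℝ)) ζ := by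
  have hm : Measurable fun s : Fin n → Rpos => ∏ a, (s (p a) : ℝ) :=
    Finset.measurable_prod _ fun a _ => measurable_coe_apply (p a)
  refine ⟨hm.aestronglyMeasurable, ?_⟩
  rw [hasFiniteIntegral_iff_ofReal (Eventually.of_forall fun s =>
    Finset.prod_nonneg fun a _ => (s (p a)).2.le)]
  exact (h.lintegral_prod_le p).trans_lt ENNReal.ofReal_lt_top

theorem integral_linear_pow_eq {ζ ζ' : Measure (Fin n → Rpos)} {A B : ℝ}
    (h : HasMomentGrowth ζ A B) (h' : HasMomentGrowth ζ' A B)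
    (hmom : ∀ i, moment ζ i = moment ζ' i) (t : Fin n → ℝ) (k : ℕ) :
    ∫ s, (∑ j, t j * (s j : ℝ)) ^ k ∂ζ = ∫ s, (∑ j, t j * (s j : ℝ)) ^ k ∂ζ' := by
  simp_rw [Fintype.sum_pow, Finset.prod_mul_distrib]
  rw [integral_finsetSum _ fun p _ => (h.integrable_prod p).const_mul _,
    integral_finsetSum _ fun p _ => (h'.integrable_prod p).const_mul _]
  refine Finset.sum_congr rfl fun p _ => ?_
  rw [integral_const_mul, integral_const_mul]
  congr 1
  have hm : Measurable fun s : Fin n → Rpos => ∏ a, (s (p a) : ℝ) :=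
    Finset.measurable_prod _ fun a _ => measurable_coe_apply (p a)
  have hpos : ∀ s : Fin n → Rpos, 0 ≤ ∏ a, (s (p a) : ℝ) := fun s =>
    Finset.prod_nonneg fun a _ => (s (p a)).2.le
  rw [integral_eq_lintegral_of_nonneg_ae (Eventually.of_forall hpos) hm.aestronglyMeasurable,
    integral_eq_lintegral_of_nonneg_ae (Eventually.of_forall hpos) hm.aestronglyMeasurable]
  congr 1
  have := hmom fun j => (Finset.univ.filter fun a => p a = j).card
  simp_rw [moment, ← fun s : Fin n → Rpos => prod_comp_eq_prod_pow p fun j => (s j : ℝ)] at this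
  exact this

theorem HasMomentGrowth.integrable_exp_linear {ζ : Measure (Fin n → Rpos)} {A B : ℝ}
    (hB : 0 ≤ B) (h : HasMomentGrowth ζ A B) {ε : ℝ} (hεB : ε * (n * B) < 1)
    {t : Fin n → ℝ} {u : ℝ} (ht : ∀ j, |u * t j| ≤ ε) (hε : 0 ≤ ε) :
    Integrable (fun s => Real.exp (u * ∑ j, t j * (s j : ℝ))) ζ := by
  have hm : Measurable fun s : Fin n → Rpos => Real.exp (u * ∑ j, t j * (s j : ℝ)) :=
    Real.measurable_exp.comp ((Finset.measurable_sum _ fun j _ =>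
      (measurable_coe_apply j).const_mul _).const_mul _)
  refine ⟨hm.aestronglyMeasurable, ?_⟩
  rw [hasFiniteIntegral_iff_ofReal (Eventually.of_forall fun s => (Real.exp_pos _).le)]
  refine lt_of_le_of_lt (lintegral_mono fun s => ENNReal.ofReal_le_ofReal
    (Real.exp_le_exp.2 ?_)) (h.lintegral_exp_lt_top hB hε hεB)
  rw [Finset.mul_sum, Finset.mul_sum]
  refine Finset.sum_le_sum fun j _ => ?_
  rw [← mul_assoc]
  exact mul_le_mul_of_nonneg_right ((le_abs_self _).trans (ht j)) (s j).2.le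

/-- Finite measures on `(0,∞)ⁿ` whose moments of order `k` are at most `A * B ^ k * k!` are
determined by their moments. -/
theorem HasMomentGrowth.ext {ζ ζ' : Measure (Fin n → Rpos)} [IsFiniteMeasure ζ]
    [IsFiniteMeasure ζ'] {A B : ℝ} (hB : 0 ≤ B) (h : HasMomentGrowth ζ A B)
    (h' : HasMomentGrowth ζ' A B) (hmom : ∀ i, moment ζ i = moment ζ' i) : ζ = ζ' := by
  let ι : (Fin n → Rpos) → (Fin n → ℝ) := fun s j => s j
  have hι : Measurable ι := measurable_pi_lambda _ measurable_coe_apply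
  -- A measurable left inverse of the inclusion into `ℝⁿ`, so that nothing is lost by comparing the
  -- image measures there.
  let π : (Fin n → ℝ) → (Fin n → Rpos) := fun v j => massToRpos (ENNReal.ofReal (v j))
  have hπ : Measurable π := measurable_pi_lambda _ fun j =>
    measurable_massToRpos.comp (measurable_pi_apply j).ennreal_ofReal
  have hπι : π ∘ ι = id := by
    funext s j
    have : (0 : ℝ) < s j := (s j).2
    simp [π, ι, massToRpos, ENNReal.toReal_ofReal this.le, this]
  suffices hmap : ζ.map ι = ζ'.map ι by
    have := congrArg (Measure.map π) hmap
    rwa [Measure.map_map hπ hι, Measure.map_map hπ hι, hπι, Measure.map_id, Measure.map_id] at this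
  -- Cramér–Wold: the characteristic function at `L` is the complex moment generating function at
  -- `i` of one linear form of the marks.
  refine Measure.ext_of_charFunDual ?_
  ext L
  let t : Fin n → ℝ := fun j => L (Pi.single j 1)
  have hL : ∀ s, L (ι s) = ∑ j, t j * (s j : ℝ) := by
    intro s
    conv_lhs => rw [← Finset.univ_sum_single (ι s), map_sum]
    refine Finset.sum_congr rfl fun j _ => ?_
    rw [mul_comm, ← smul_eq_mul, ← map_smul, ← Pi.single_smul, smul_eq_mul, mul_one]
  have hchar : ∀ R : Measure (Fin n → Rpos), charFunDual (R.map ι) L =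
      complexMGF (fun s => ∑ j, t j * (s j : ℝ)) R Complex.I := by
    intro R
    rw [charFunDual_apply, integral_map hι.aemeasurable (by fun_prop)]
    simp_rw [hL, complexMGF, mul_comm Complex.I]
  rw [hchar, hchar]
  -- The choice ensures `ε * (n * B) < 1`, and `τ` below dominates every `|t j|`, so `|u| < ε / τ`
  -- gives `|u * t j| ≤ ε`. The summands `+ 1` keep both denominators positive.
  set ε : ℝ := 1 / (n * B + 1) with hεdef
  have hε : 0 < ε := by positivity
  have hεB : ε * (n * B) < 1 := by
    rw [hεdef, one_div, inv_mul_lt_iff₀ (by positivity)]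
    linarith
  set τ : ℝ := ∑ j, |t j| + 1 with hτdef
  have hτ : 0 < τ := by positivity
  have hr : ∀ u ∈ Ioo (-(ε / τ)) (ε / τ), ∀ j, |u * t j| ≤ ε := by
    intro u hu j
    have h1 : |u| ≤ ε / τ := (abs_lt.2 hu).le
    have h2 : |t j| ≤ τ := by
      have := Finset.single_le_sum (f := fun j => |t j|) (fun j _ => abs_nonneg _)
        (Finset.mem_univ j)
      linarith
    calc |u * t j| = |u| * |t j| := abs_mul _ _
      _ ≤ ε / τ * τ := by gcongr
      _ = ε := by field_simp
  exact complexMGF_I_eq_of_moments (div_pos hε hτ)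
    (fun u hu => h.integrable_exp_linear hB hεB (hr u hu) hε.le)
    (fun u hu => h'.integrable_exp_linear hB hεB (hr u hu) hε.le)
    (integral_linear_pow_eq h h' hmom t)

end Determinacy

/-! ### Block diagonals and the moment measures on them. -/

section Blocks

variable {X : Type*} {n : ℕ}

/-- The tuple in which the `j`-th coordinate of `y` is repeated `i j` times. -/
def blockExpand (i : Fin n → ℕ) (y : OffDiag X n) : BlockDiag X i :=
  ⟨fun a => y.1 (blockIndex i a), fun _ _ => y.2.eq_iff⟩

theorem blockIndex_finSigmaFinEquiv (i : Fin n → ℕ) (j : Fin n) (b : Fin (i j)) :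
    blockIndex i (finSigmaFinEquiv ⟨j, b⟩) = j := by
  simp [blockIndex]

theorem blockCollapse_blockExpand (i : Fin n → ℕ) (hi : ∀ j, 0 < i j) (y : OffDiag X n) :
    blockCollapse i hi (blockExpand i y) = y :=
  Subtype.ext <| funext fun j => congrArg y.1 (blockIndex_finSigmaFinEquiv i j ⟨0, hi j⟩)

theorem blockExpand_blockCollapse (i : Fin n → ℕ) (hi : ∀ j, 0 < i j) (x : BlockDiag X i) :
    blockExpand i (blockCollapse i hi x) = x :=
  Subtype.ext <| funext fun a => (x.2 _ a).2 (blockIndex_finSigmaFinEquiv i _ ⟨0, hi _⟩)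

theorem prod_blockIndex {M : Type*} [CommMonoid M] (i : Fin n → ℕ) (F : Fin n → M) :
    ∏ a, F (blockIndex i a) = ∏ j, F j ^ i j := by
  rw [← finSigmaFinEquiv.prod_comp, Fintype.prod_sigma]
  simp [blockIndex_finSigmaFinEquiv]

/-- The set of tuples with block structure `i` whose collapse lies in `Δ`. -/
def blockSet (i : Fin n → ℕ) (Δ : Set (OffDiag X n)) : Set (Fin (∑ j, i j) → X) :=
  (fun y => (blockExpand i y).1) '' Δ

theorem image_preimage_blockCollapse (i : Fin n → ℕ) (hi : ∀ j, 0 < i j) (Δ : Set (OffDiag X n)) :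
    Subtype.val '' (blockCollapse i hi ⁻¹' Δ) = blockSet i Δ := by
  ext w
  constructor
  · rintro ⟨x, hx, rfl⟩
    exact ⟨_, hx, congrArg Subtype.val (blockExpand_blockCollapse i hi x)⟩
  · rintro ⟨y, hy, rfl⟩
    exact ⟨_, by rwa [mem_preimage, blockCollapse_blockExpand], rfl⟩

theorem blockExpand_mem_blockSet_iff (i : Fin n → ℕ) (hi : ∀ j, 0 < i j) (Δ : Set (OffDiag X n))
    (y : OffDiag X n) : (blockExpand i y).1 ∈ blockSet i Δ ↔ y ∈ Δ := by
  refine ⟨?_, fun h => ⟨y, h, rfl⟩⟩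
  rintro ⟨z, hz, h⟩
  have := congrArg (blockCollapse i hi) (Subtype.ext h)
  rw [blockCollapse_blockExpand, blockCollapse_blockExpand] at this
  exact this ▸ hz

variable [TopologicalSpace X] [T2Space X] [LocallyCompactSpace X] [SecondCountableTopology X]
  [MeasurableSpace X] [BorelSpace X]

theorem measurableSet_blockDiag (i : Fin n → ℕ) :
    MeasurableSet {x : Fin (∑ j, i j) → X |
      ∀ a b, x a = x b ↔ blockIndex i a = blockIndex i b} := by
  have : {x : Fin (∑ j, i j) → X | ∀ a b, x a = x b ↔ blockIndex i a = blockIndex i b} =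
      ⋂ (a) (b), {x | x a = x b ↔ blockIndex i a = blockIndex i b} := by
    ext x
    simp
  rw [this]
  refine .iInter fun a => .iInter fun b => ?_
  have h : MeasurableSet {x : Fin (∑ j, i j) → X | x a = x b} :=
    measurableSet_eq_fun (measurable_pi_apply a) (measurable_pi_apply b)
  by_cases hab : blockIndex i a = blockIndex i b
  · simpa [hab] using h
  · simp only [hab, iff_false]
    exact h.compl

theorem measurable_blockCollapse (i : Fin n → ℕ) (hi : ∀ j, 0 < i j) :
    Measurable (blockCollapse (X := X) i hi) := by
  have h : Measurable fun (x : BlockDiag X i) (j : Fin n) =>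
      x.1 (finSigmaFinEquiv ⟨j, ⟨0, hi j⟩⟩) := measurable_pi_lambda _ fun j =>
    (measurable_pi_apply _).comp measurable_subtype_coe
  exact h.subtype_mk

theorem measurableSet_blockSet (i : Fin n → ℕ) (hi : ∀ j, 0 < i j) {Δ : Set (OffDiag X n)}
    (hΔ : MeasurableSet Δ) : MeasurableSet (blockSet i Δ) := by
  rw [← image_preimage_blockCollapse i hi]
  exact (measurableSet_blockDiag i).subtype_image (measurable_blockCollapse i hi hΔ)

theorem blockMeasure_apply (i : Fin n → ℕ) (hi : ∀ j, 0 < i j)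
    (m : Measure (Fin (∑ j, i j) → X)) {Δ : Set (OffDiag X n)} (hΔ : MeasurableSet Δ) :
    blockMeasure i hi m Δ = m (blockSet i Δ) := by
  rw [blockMeasure, Measure.map_apply (measurable_blockCollapse i hi) hΔ,
    (MeasurableEmbedding.subtype_coe (measurableSet_blockDiag i)).comap_apply,
    image_preimage_blockCollapse]

theorem momentMeasure_apply (μ : Measure (RadonMeasure X)) (N : ℕ) {T : Set (Fin N → X)}
    (hT : MeasurableSet T) :
    momentMeasure μ N T = ∫⁻ η, Measure.pi (fun _ : Fin N => η.1) T ∂μ :=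
  Measure.bind_apply hT (RadonMeasure.measurable_pi N).aemeasurable

end Blocks

/-! ### Tuples of atoms of a discrete measure. -/

section Tuples

variable {X : Type*} [TopologicalSpace X] [T2Space X] [LocallyCompactSpace X]
  [SecondCountableTopology X] [MeasurableSpace X] [BorelSpace X] {n : ℕ}

/-- The marked tuples all of whose entries are points of `atomMap η`. -/
abbrev AtomTuple (η : RadonMeasure X) (n : ℕ) : Type _ :=
  {v : MarkedTuple X n // ∀ j, v.1 j ∈ (atomMap η).1}

/-- The counting measure on the tuples of distinct points of `atomMap η`. -/
def tupleMeasure (n : ℕ) (η : RadonMeasure X) : Measure (MarkedTuple X n) :=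
  Measure.sum fun v : AtomTuple η n => Measure.dirac v.1

theorem lintegral_tupleMeasure (η : RadonMeasure X) {g : MarkedTuple X n → ℝ≥0∞}
    (hg : Measurable g) : ∫⁻ v, g v ∂tupleMeasure n η = ∑' v : AtomTuple η n, g v.1 := by
  rw [tupleMeasure, lintegral_sum_measure]
  exact tsum_congr fun v => lintegral_dirac' _ hg

theorem measurable_points : Measurable (MarkedTuple.points : MarkedTuple X n → OffDiag X n) :=
  Measurable.subtype_mk <| measurable_pi_lambda _ fun j =>
    measurable_fst.comp ((measurable_pi_apply j).comp measurable_subtype_coe)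

theorem measurable_marks : Measurable (MarkedTuple.marks : MarkedTuple X n → Fin n → Rpos) :=
  measurable_pi_lambda _ fun j =>
    measurable_snd.comp ((measurable_pi_apply j).comp measurable_subtype_coe)

theorem measurable_perm (σ : Equiv.Perm (Fin n)) :
    Measurable (MarkedTuple.perm σ : MarkedTuple X n → MarkedTuple X n) := by
  have h : Measurable fun (v : MarkedTuple X n) (j : Fin n) => v.1 (σ j) :=
    measurable_pi_lambda _ fun j => (measurable_pi_apply (σ j)).comp measurable_subtype_coe
  exact h.subtype_mk

theorem measurableSet_markedTuple :
    MeasurableSet {v : Fin n → X × Rpos | Function.Injective fun j => (v j).1} :=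
  (measurable_pi_lambda (fun (v : Fin n → X × Rpos) j => (v j).1) fun j =>
    measurable_fst.comp (measurable_pi_apply j)) (measurableSet_injective n)

theorem MarkedTuple.injective_val (v : MarkedTuple X n) : Function.Injective v.1 :=
  Function.Injective.of_comp (f := Prod.fst) v.2

theorem preimage_toFiniteConfiguration (B : Set (FiniteConfiguration (X × Rpos))) :
    (MarkedTuple.toFiniteConfiguration : MarkedTuple X n → _) ⁻¹' B =
      Subtype.val ⁻¹' tuplesInto n B := by
  ext v
  exact ⟨fun h => ⟨v.injective_val, h⟩, fun h => h.2⟩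

theorem measurable_toFiniteConfiguration : Measurable
    (MarkedTuple.toFiniteConfiguration : MarkedTuple X n → FiniteConfiguration (X × Rpos)) := by
  intro B hB
  rw [preimage_toFiniteConfiguration]
  exact measurable_subtype_coe (measurableSet_tuplesInto n hB)

/-- An atom has only one mass, so distinct points of `atomMap η` have distinct positions: injective
tuples of such points lie in `𝒱ₙ` automatically. -/
theorem pi_toRadon_atomMap (η : RadonMeasure X) {S : Set (Fin n → X × Rpos)}
    (hS : MeasurableSet S) (hinj : ∀ v ∈ S, Function.Injective v) :
    Measure.pi (fun _ : Fin n => (atomMap η).toRadon.1) S =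
      tupleMeasure n η (Subtype.val ⁻¹' S) := by
  have hS' : MeasurableSet ((Subtype.val : MarkedTuple X n → _) ⁻¹' S) := measurable_subtype_coe hS
  rw [← lintegral_indicator_one hS, ← lintegral_indicator_one hS', lintegral_pi_toRadon,
    lintegral_tupleMeasure η (measurable_one.indicator hS')]
  let e : AtomTuple η n → {v : Fin n → X × Rpos | ∀ j, v j ∈ (atomMap η).1} :=
    fun v => ⟨v.1.1, v.2⟩
  have he : Function.Injective e := fun v w h => by
    have h1 := congrArg Subtype.val h
    exact Subtype.ext (Subtype.ext h1)
  rw [← he.tsum_eq]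
  · rfl
  · intro v hv
    have hvS : v.1 ∈ S := by
      by_contra h
      exact hv (indicator_of_notMem h _)
    exact ⟨⟨⟨v.1, fun j k hjk => hinj _ hvS (eq_of_mem_atomMap (v.2 j) (v.2 k) hjk)⟩, v.2⟩, rfl⟩

theorem measurable_tupleMeasure : Measurable (tupleMeasure (X := X) n) := by
  refine Measure.measurable_of_measurable_coe _ fun B hB => ?_
  have hS : MeasurableSet (Subtype.val '' B : Set (Fin n → X × Rpos)) :=
    measurableSet_markedTuple.subtype_image hB
  have : ∀ η : RadonMeasure X, tupleMeasure n η B =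
      Measure.pi (fun _ : Fin n => (atomMap η).toRadon.1) (Subtype.val '' B) := by
    intro η
    rw [pi_toRadon_atomMap η hS, preimage_image_eq _ Subtype.val_injective]
    rintro _ ⟨v, -, rfl⟩
    exact MarkedTuple.injective_val v
  simp_rw [this]
  exact (Measure.measurable_measure.1 (measurable_pi_toRadon n) _ hS).comp measurable_atomMap

theorem tupleMeasure_map_perm (σ : Equiv.Perm (Fin n)) (η : RadonMeasure X) {B : Set (MarkedTuple X n)}
    (hB : MeasurableSet B) :
    tupleMeasure n η (MarkedTuple.perm σ ⁻¹' B) = tupleMeasure n η B := by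
  have hB' := measurable_perm σ hB
  rw [← lintegral_indicator_one hB, ← lintegral_indicator_one hB',
    lintegral_tupleMeasure η (measurable_one.indicator hB),
    lintegral_tupleMeasure η (measurable_one.indicator hB')]
  let e : AtomTuple η n ≃ AtomTuple η n :=
    { toFun := fun v => ⟨MarkedTuple.perm σ v.1, fun j => v.2 (σ j)⟩
      invFun := fun v => ⟨MarkedTuple.perm σ⁻¹ v.1, fun j => v.2 (σ⁻¹ j)⟩
      left_inv := fun v => Subtype.ext <| Subtype.ext <| funext fun j => by
        simp [MarkedTuple.perm]
      right_inv := fun v => Subtype.ext <| Subtype.ext <| funext fun j => by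
        simp [MarkedTuple.perm] }
  exact e.tsum_eq fun v => B.indicator 1 v.1

theorem exists_countable_of_mem_discreteCone {η : RadonMeasure X} (h : η ∈ discreteCone X) :
    ∃ S : Set X, S.Countable ∧ η.1 Sᶜ = 0 := by
  obtain ⟨S, s, hS, -, hη⟩ := h
  refine ⟨S, hS, ?_⟩
  have := hS.to_subtype
  rw [hη, Measure.sum_apply _ hS.measurableSet.compl]
  simp

/-- For a discrete measure, the mass of a block set is a sum over the tuples of atoms. -/
theorem pi_blockSet {η : RadonMeasure X} (h : η ∈ discreteCone X) (i : Fin n → ℕ)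
    (hi : ∀ j, 0 < i j) {Δ : Set (OffDiag X n)} (hΔ : MeasurableSet Δ) :
    Measure.pi (fun _ : Fin (∑ j, i j) => η.1) (blockSet i Δ) =
      ∫⁻ v in MarkedTuple.points ⁻¹' Δ, ENNReal.ofReal (∏ j, (v.marks j : ℝ) ^ i j)
        ∂tupleMeasure n η := by
  obtain ⟨S, hS, hη⟩ := exists_countable_of_mem_discreteCone h
  have hm : Measurable fun v : MarkedTuple X n =>
      ENNReal.ofReal (∏ j, (v.marks j : ℝ) ^ i j) :=
    (Finset.measurable_prod _ fun j _ =>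
      ((measurable_coe_apply j).comp measurable_marks).pow_const _).ennreal_ofReal
  have hΔ' := measurable_points hΔ
  rw [← lintegral_indicator hΔ', lintegral_tupleMeasure η (hm.indicator hΔ'),
    ← lintegral_indicator_one (measurableSet_blockSet i hi hΔ),
    lintegral_pi_of_countable η.1 hS hη]
  let e : AtomTuple η n → (Fin (∑ j, i j) → X) := fun v => (blockExpand i v.1.points).1
  have he : Function.Injective e := by
    intro v w hvw
    have h1 := congrArg (blockCollapse i hi) (Subtype.ext hvw)
    rw [blockCollapse_blockExpand, blockCollapse_blockExpand] at h1
    refine Subtype.ext (Subtype.ext (funext fun j => eq_of_mem_atomMap (v.2 j) (w.2 j) ?_))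
    exact congrFun (congrArg Subtype.val h1) j
  rw [← he.tsum_eq]
  · refine tsum_congr fun v => ?_
    -- Repeating the `j`-th atom `i j` times contributes its mass to the power `i j`.
    have hmass : ∏ a, η.1 {e v a} = ENNReal.ofReal (∏ j, (v.1.marks j : ℝ) ^ i j) := by
      have h1 : ∀ j, η.1 {(v.1.1 j).1} = ENNReal.ofReal (v.1.marks j) := v.2
      change ∏ a, η.1 {(v.1.1 (blockIndex i a)).1} = _
      simp_rw [h1]
      rw [prod_blockIndex i fun j => ENNReal.ofReal (v.1.marks j),
        ENNReal.ofReal_prod_of_nonneg fun j _ => pow_nonneg (v.1.marks j).2.le _]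
      exact Finset.prod_congr rfl fun j _ => (ENNReal.ofReal_pow (v.1.marks j).2.le _).symm
    rw [hmass]
    by_cases hv : v.1.points ∈ Δ
    · rw [indicator_of_mem ((blockExpand_mem_blockSet_iff i hi Δ _).2 hv),
        indicator_of_mem (s := MarkedTuple.points ⁻¹' Δ) hv, Pi.one_apply, one_mul]
    · rw [indicator_of_notMem fun h' => hv ((blockExpand_mem_blockSet_iff i hi Δ _).1 h'),
        indicator_of_notMem (s := MarkedTuple.points ⁻¹' Δ) hv, zero_mul]
  -- A tuple with nonzero contribution is the block expansion of some `y` whose coordinates are all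
  -- atoms; attaching their masses as marks gives its preimage under `e`.
  · intro w hw
    obtain ⟨hw1, hw2⟩ := mul_ne_zero_iff.1 hw
    have hwT : w ∈ blockSet i Δ := by
      by_contra h
      exact hw1 (indicator_of_notMem h _)
    obtain ⟨y, -, rfl⟩ := hwT
    have hy : ∀ j, η.1 {y.1 j} ≠ 0 := by
      intro j
      have := Finset.prod_ne_zero_iff.1 hw2 (finSigmaFinEquiv ⟨j, ⟨0, hi j⟩⟩) (Finset.mem_univ _)
      simpa [blockExpand, blockIndex_finSigmaFinEquiv] using this
    exact ⟨⟨⟨fun j => (y.1 j, massToRpos (η.1 {y.1 j})), y.2⟩, fun j =>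
      (η.ofReal_massToRpos (hy j)).symm⟩, rfl⟩

end Tuples

/-! ### The explicit solution, its moments, and the uniqueness statements. -/

section Gluing

variable {X : Type*} [TopologicalSpace X] [T2Space X] [LocallyCompactSpace X]
  [SecondCountableTopology X] [MeasurableSpace X] [BorelSpace X] {n : ℕ}

/-- The factorial moment measure of the point process `atomMap η`, divided by `n!`. -/
def factorialMeasure (μ : Measure (RadonMeasure X)) (n : ℕ) : Measure (MarkedTuple X n) :=
  (n ! : ℝ≥0∞)⁻¹ • μ.bind (tupleMeasure n)

theorem factorialMeasure_apply (μ : Measure (RadonMeasure X)) {B : Set (MarkedTuple X n)}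
    (hB : MeasurableSet B) :
    factorialMeasure μ n B = (n ! : ℝ≥0∞)⁻¹ * ∫⁻ η, tupleMeasure n η B ∂μ := by
  rw [factorialMeasure, Measure.smul_apply, smul_eq_mul,
    Measure.bind_apply hB measurable_tupleMeasure.aemeasurable]

theorem lintegral_factorialMeasure (μ : Measure (RadonMeasure X)) {g : MarkedTuple X n → ℝ≥0∞}
    (hg : Measurable g) :
    ∫⁻ v, g v ∂factorialMeasure μ n =
      (n ! : ℝ≥0∞)⁻¹ * ∫⁻ η, ∫⁻ v, g v ∂tupleMeasure n η ∂μ := by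
  rw [factorialMeasure, lintegral_smul_measure, smul_eq_mul,
    Measure.lintegral_bind measurable_tupleMeasure.aemeasurable hg.aemeasurable]

theorem factorialMeasure_map_perm (μ : Measure (RadonMeasure X)) (σ : Equiv.Perm (Fin n)) :
    (factorialMeasure μ n).map (MarkedTuple.perm σ) = factorialMeasure μ n := by
  ext B hB
  rw [Measure.map_apply (measurable_perm σ) hB, factorialMeasure_apply μ (measurable_perm σ hB),
    factorialMeasure_apply μ hB]
  simp_rw [tupleMeasure_map_perm σ _ hB]

/-- For fixed `η` both sides count `n`-point subsets of `atomMap η`: on the left through their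
enumerations, divided by `n!`. -/
theorem factorialMeasure_map_toFiniteConfiguration (μ : Measure (RadonMeasure X)) :
    (factorialMeasure μ n).map MarkedTuple.toFiniteConfiguration =
      ((μ.map atomMap).bind subconfigurationMeasure).restrict
        (configurationsOfCard (X × Rpos) n) := by
  ext B hB
  have hBn := hB.inter (measurableSet_configurationsOfCard n)
  have hn : (n ! : ℝ≥0∞)⁻¹ ≠ ∞ := by
    simpa using n.factorial_ne_zero
  rw [Measure.map_apply measurable_toFiniteConfiguration hB, Measure.restrict_apply hB,
    Measure.bind_apply hBn measurable_subconfigurationMeasure.aemeasurable,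
    lintegral_map (Measure.measurable_measure.1 measurable_subconfigurationMeasure _ hBn)
      measurable_atomMap,
    factorialMeasure_apply μ (measurable_toFiniteConfiguration hB), ← lintegral_const_mul' _ _ hn]
  refine lintegral_congr fun η => ?_
  rw [subconfigurationMeasure_inter_card _ n hB, preimage_toFiniteConfiguration,
    pi_toRadon_atomMap η (measurableSet_tuplesInto n hB) fun v hv => hv.1]

/-- The product of the marks, as a density. -/
def marksDensity (v : MarkedTuple X n) : ℝ≥0∞ := ENNReal.ofReal (∏ j, (v.marks j : ℝ))

theorem measurable_marksDensity : Measurable (marksDensity : MarkedTuple X n → ℝ≥0∞) :=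
  (Finset.measurable_prod _ fun j _ =>
    (measurable_coe_apply j).comp measurable_marks).ennreal_ofReal

theorem prod_marks_pos (v : MarkedTuple X n) : 0 < ∏ j, (v.marks j : ℝ) :=
  Finset.prod_pos fun j _ => (v.marks j).2

/-- The measure on marked tuples gluing the solutions of the moment problems. -/
def gluedMeasure (μ : Measure (RadonMeasure X)) (n : ℕ) : Measure (MarkedTuple X n) :=
  (factorialMeasure μ n).withDensity marksDensity

/-- The density is positive and finite everywhere, so dividing by it undoes the weighting exactly.
-/
theorem divideByMarks_gluedMeasure (μ : Measure (RadonMeasure X)) (n : ℕ) :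
    divideByMarks (gluedMeasure μ n) = factorialMeasure μ n := by
  have : ∀ v : MarkedTuple X n, ENNReal.ofReal (∏ j, (v.marks j : ℝ))⁻¹ = (marksDensity v)⁻¹ :=
    fun v => ENNReal.ofReal_inv_of_pos (prod_marks_pos v)
  rw [divideByMarks, gluedMeasure]
  simp_rw [this]
  refine withDensity_inv_same measurable_marksDensity (Eventually.of_forall fun v => ?_)
    (Eventually.of_forall fun v => ENNReal.ofReal_ne_top)
  exact (ENNReal.ofReal_pos.2 (prod_marks_pos v)).ne'

/-- The mark distribution of `ξ` over `Δ`. -/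
def markMeasure (ξ : Measure (MarkedTuple X n)) (Δ : Set (OffDiag X n)) :
    Measure (Fin n → Rpos) :=
  (ξ.restrict (MarkedTuple.points ⁻¹' Δ)).map MarkedTuple.marks

theorem markMeasure_apply (ξ : Measure (MarkedTuple X n)) (Δ : Set (OffDiag X n))
    {A : Set (Fin n → Rpos)} (hA : MeasurableSet A) :
    markMeasure ξ Δ A = ξ {v | v.points ∈ Δ ∧ v.marks ∈ A} := by
  rw [markMeasure, Measure.map_apply measurable_marks hA,
    Measure.restrict_apply (measurable_marks hA), inter_comm]
  rfl

/-- The weight `s₁⋯sₙ` raises each exponent by one, after which `pi_blockSet` applies to almost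
every `η`. -/
theorem lintegral_markMeasure_gluedMeasure {μ : Measure (RadonMeasure X)}
    (hdiscrete : ∀ᵐ η ∂μ, η ∈ discreteCone X) {Δ : Set (OffDiag X n)} (hΔ : MeasurableSet Δ)
    (i : Fin n → ℕ) :
    ∫⁻ s, ENNReal.ofReal (∏ j, (s j : ℝ) ^ i j) ∂markMeasure (gluedMeasure μ n) Δ =
      blockMeasure (fun j => i j + 1) (fun j => Nat.succ_pos (i j))
        (momentMeasure μ (∑ j, (i j + 1))) Δ / (n ! : ℝ≥0∞) := by
  have hi : ∀ j, 0 < i j + 1 := fun j => Nat.succ_pos (i j)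
  have hm : ∀ i : Fin n → ℕ, Measurable fun s : Fin n → Rpos =>
      ENNReal.ofReal (∏ j, (s j : ℝ) ^ i j) := fun i =>
    (Finset.measurable_prod _ fun j _ => (measurable_coe_apply j).pow_const _).ennreal_ofReal
  have hΔ' : MeasurableSet ((MarkedTuple.points : MarkedTuple X n → _) ⁻¹' Δ) :=
    measurable_points hΔ
  have hmul : ∀ v : MarkedTuple X n, marksDensity v * ENNReal.ofReal (∏ j, (v.marks j : ℝ) ^ i j) =
      ENNReal.ofReal (∏ j, (v.marks j : ℝ) ^ (i j + 1)) := by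
    intro v
    rw [marksDensity, ← ENNReal.ofReal_mul (prod_marks_pos v).le, ← Finset.prod_mul_distrib]
    simp_rw [pow_succ']
  have hmi : Measurable fun v : MarkedTuple X n => ENNReal.ofReal (∏ j, (v.marks j : ℝ) ^ i j) :=
    (hm i).comp measurable_marks
  rw [markMeasure, lintegral_map (hm i) measurable_marks, gluedMeasure,
    restrict_withDensity hΔ', lintegral_withDensity_eq_lintegral_mul _ measurable_marksDensity hmi]
  simp_rw [Pi.mul_apply, hmul]
  have hm' : Measurable fun v : MarkedTuple X n =>
      ENNReal.ofReal (∏ j, (v.marks j : ℝ) ^ (i j + 1)) := (hm fun j => i j + 1).comp measurable_marks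
  rw [← lintegral_indicator hΔ', lintegral_factorialMeasure μ (hm'.indicator hΔ'),
    blockMeasure_apply _ hi _ hΔ, momentMeasure_apply μ _ (measurableSet_blockSet _ hi hΔ),
    ENNReal.div_eq_inv_mul]
  congr 1
  refine lintegral_congr_ae ?_
  filter_upwards [hdiscrete] with η hη
  rw [pi_blockSet hη _ hi hΔ, lintegral_indicator hΔ']

/-- The moments over a bounded set grow at most factorially. -/
theorem exists_blockMeasure_le {μ : Measure (RadonMeasure X)} (hC1 : ConditionC1 μ) (hn : 1 ≤ n)
    {Δ : Set (OffDiag X n)} (hΔ : IsBoundedBorel Δ) :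
    ∃ A B : ℝ, 0 ≤ B ∧ ∀ i : Fin n → ℕ,
      blockMeasure (fun j => i j + 1) (fun j => Nat.succ_pos (i j))
        (momentMeasure μ (∑ j, (i j + 1))) Δ / (n ! : ℝ≥0∞) ≤
      ENNReal.ofReal (A * B ^ (∑ j, i j) * (∑ j, i j)!) := by
  -- The union of the coordinate projections of the closure of `Δ`: a single compact set with `Δ ⊆
  -- Λⁿ`, to which (C1) applies.
  let Λ : Set X := ⋃ j : Fin n, Function.eval j '' closure (Subtype.val '' Δ)
  have hΛ : IsCompact Λ := isCompact_iUnion fun j => hΔ.2.image (continuous_apply j)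
  obtain ⟨C, hC, hCn⟩ := hC1 Λ hΛ.measurableSet (by rwa [hΛ.isClosed.closure_eq])
  -- The total order is `k + n` with `k = ∑ j, i j`, and `(k + n)! ≤ 2 ^ (k + n) * k! * n!` splits
  -- off a factor independent of `i`.
  refine ⟨(2 * C) ^ n * n !, 2 * C, by positivity, fun i => ?_⟩
  have hi : ∀ j, 0 < i j + 1 := fun j => Nat.succ_pos (i j)
  have hsum : ∑ j, (i j + 1) = ∑ j, i j + n := by simp [Finset.sum_add_distrib]
  calc _ ≤ blockMeasure (fun j => i j + 1) hi (momentMeasure μ (∑ j, (i j + 1))) Δ := by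
        refine ENNReal.div_le_of_le_mul (le_mul_of_one_le_right' ?_)
        exact_mod_cast n.factorial_pos
    _ ≤ momentMeasure μ (∑ j, (i j + 1)) (univ.pi fun _ => Λ) := by
        rw [blockMeasure_apply _ hi _ hΔ.1]
        refine measure_mono ?_
        rintro _ ⟨y, hy, rfl⟩ a -
        exact mem_iUnion.2 ⟨blockIndex (fun j => i j + 1) a, y.1,
          subset_closure (mem_image_of_mem _ hy), rfl⟩
    _ ≤ ENNReal.ofReal (C ^ (∑ j, (i j + 1)) * (∑ j, (i j + 1))!) :=
        hCn _ (by rw [hsum]; omega)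
    _ ≤ _ := by
        refine ENNReal.ofReal_le_ofReal ?_
        rw [hsum]
        set k := ∑ j, i j
        have h1 : ((k + n)! : ℝ) ≤ 2 ^ (k + n) * k ! * n ! := by
          rw [← Nat.add_choose_mul_factorial_mul_factorial]
          push_cast
          gcongr
          exact_mod_cast Nat.choose_le_two_pow _ _
        calc C ^ (k + n) * ((k + n)! : ℝ) ≤ C ^ (k + n) * (2 ^ (k + n) * k ! * n !) := by gcongr
          _ = (2 * C) ^ n * n ! * (2 * C) ^ k * k ! := by ring

/-- Only finiteness is left to check: the total mass is the moment of order zero, which (C1) bounds.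
-/
theorem solvesMomentProblem_markMeasure {μ : Measure (RadonMeasure X)}
    (hdiscrete : ∀ᵐ η ∂μ, η ∈ discreteCone X) (hC1 : ConditionC1 μ) (hn : 1 ≤ n)
    {Δ : Set (OffDiag X n)} (hΔ : IsBoundedBorel Δ) :
    SolvesMomentProblem μ Δ (markMeasure (gluedMeasure μ n) Δ) := by
  have hmom := lintegral_markMeasure_gluedMeasure hdiscrete hΔ.1
  refine ⟨⟨?_⟩, hmom⟩
  obtain ⟨A, B, -, hAB⟩ := exists_blockMeasure_le hC1 hn hΔ
  have h0 := (hmom 0).trans_le (hAB 0)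
  simp only [Pi.zero_apply, pow_zero, Finset.prod_const_one, ENNReal.ofReal_one,
    lintegral_one] at h0
  exact h0.trans_lt ENNReal.ofReal_lt_top

theorem SolvesMomentProblem.unique {μ : Measure (RadonMeasure X)} (hC1 : ConditionC1 μ)
    (hn : 1 ≤ n) {Δ : Set (OffDiag X n)} (hΔ : IsBoundedBorel Δ) {ζ ζ' : Measure (Fin n → Rpos)}
    (h : SolvesMomentProblem μ Δ ζ) (h' : SolvesMomentProblem μ Δ ζ') : ζ = ζ' := by
  obtain ⟨A, B, hB, hAB⟩ := exists_blockMeasure_le hC1 hn hΔ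
  have := h.1
  have := h'.1
  exact HasMomentGrowth.ext hB (fun i => (h.2 i).trans_le (hAB i))
    (fun i => (h'.2 i).trans_le (hAB i)) fun i => (h.2 i).trans (h'.2 i).symm

theorem gluesMomentSolutions_gluedMeasure {μ : Measure (RadonMeasure X)}
    (hdiscrete : ∀ᵐ η ∂μ, η ∈ discreteCone X) (hC1 : ConditionC1 μ) (hn : 1 ≤ n) :
    GluesMomentSolutions μ (gluedMeasure μ n) := by
  intro Δ hΔ ζ hζ A hA
  rw [hζ.unique hC1 hn hΔ (solvesMomentProblem_markMeasure hdiscrete hC1 hn hΔ),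
    markMeasure_apply _ Δ hA]

/-- The tuples with all coordinates in the `m`-th set of the exhaustion. -/
def offDiagExhaustion (X : Type*) [TopologicalSpace X] [LocallyCompactSpace X]
    [SecondCountableTopology X] (n m : ℕ) : Set (OffDiag X n) :=
  {y | ∀ j, y.1 j ∈ exhaustion X m}

theorem isBoundedBorel_inter_offDiagExhaustion {Δ : Set (OffDiag X n)} (hΔ : MeasurableSet Δ)
    (m : ℕ) : IsBoundedBorel (Δ ∩ offDiagExhaustion X n m) := by
  refine ⟨hΔ.inter ?_, ?_⟩
  · have : offDiagExhaustion X n m = ⋂ j, {y | y.1 j ∈ exhaustion X m} := by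
      ext y
      simp [offDiagExhaustion]
    rw [this]
    exact .iInter fun j => ((measurable_pi_apply j).comp measurable_subtype_coe)
      (isOpen_exhaustion m).measurableSet
  · have hK : IsCompact (univ.pi fun _ : Fin n => CompactExhaustion.choice X m) :=
      isCompact_univ_pi fun _ => (CompactExhaustion.choice X).isCompact m
    refine hK.of_isClosed_subset isClosed_closure (closure_minimal ?_ hK.isClosed)
    rintro _ ⟨y, hy, rfl⟩ j -
    exact interior_subset (hy.2 j)

theorem iUnion_offDiagExhaustion : ⋃ m, offDiagExhaustion X n m = univ := by
  refine eq_univ_of_forall fun y => ?_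
  have h : ∀ j, ∃ m, y.1 j ∈ exhaustion X m := fun j =>
    mem_iUnion.1 (iUnion_exhaustion (Z := X) ▸ mem_univ (y.1 j))
  choose m hm using h
  exact mem_iUnion.2 ⟨Finset.univ.sup m, fun j =>
    monotone_exhaustion (Finset.le_sup (Finset.mem_univ j)) (hm j)⟩

/-- The sets of marked tuples with points in a bounded set and marks in a given set. -/
def markedRectangles (X : Type*) [TopologicalSpace X] [MeasurableSpace X] (n : ℕ) :
    Set (Set (MarkedTuple X n)) :=
  {B | ∃ (Δ : Set (OffDiag X n)) (A : Set (Fin n → Rpos)), IsBoundedBorel Δ ∧ MeasurableSet A ∧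
    B = {v | v.points ∈ Δ ∧ v.marks ∈ A}}

theorem isPiSystem_markedRectangles : IsPiSystem (markedRectangles X n) := by
  rintro _ ⟨Δ, A, hΔ, hA, rfl⟩ _ ⟨Δ', A', hΔ', hA', rfl⟩ -
  refine ⟨Δ ∩ Δ', A ∩ A', ⟨hΔ.1.inter hΔ'.1, ?_⟩, hA.inter hA', ?_⟩
  · exact hΔ.2.of_isClosed_subset isClosed_closure
      (closure_mono (image_mono inter_subset_left))
  · ext v
    simp only [mem_inter_iff, mem_ofPred_eq]
    tauto

theorem generateFrom_markedRectangles :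
    (inferInstance : MeasurableSpace (MarkedTuple X n)) =
      MeasurableSpace.generateFrom (markedRectangles X n) := by
  apply le_antisymm
  · have key : ∀ (Δ : Set (OffDiag X n)) (A : Set (Fin n → Rpos)), MeasurableSet Δ →
        MeasurableSet A → MeasurableSet[MeasurableSpace.generateFrom (markedRectangles X n)]
          {v | v.points ∈ Δ ∧ v.marks ∈ A} := by
      intro Δ A hΔ hA
      have : {v : MarkedTuple X n | v.points ∈ Δ ∧ v.marks ∈ A} =
          ⋃ m, {v | v.points ∈ Δ ∩ offDiagExhaustion X n m ∧ v.marks ∈ A} := by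
        ext v
        have := mem_iUnion.1 (iUnion_offDiagExhaustion (X := X) (n := n) ▸ mem_univ v.points)
        simp only [mem_ofPred_eq, mem_iUnion, mem_inter_iff, exists_and_right, exists_and_left]
        tauto
      rw [this]
      exact .iUnion fun m => MeasurableSpace.measurableSet_generateFrom
        ⟨_, A, isBoundedBorel_inter_offDiagExhaustion hΔ m, hA, rfl⟩
    -- The σ-algebra of `𝒱ₙ` is generated by the coordinates `(xⱼ, sⱼ)`, and preimages under `xⱼ`
    -- and `sⱼ` are of the form treated in `key`, with a trivial condition on the other component.
    refine Measurable.comap_le (@measurable_pi_iff (MarkedTuple X n) (Fin n) (fun _ => X × Rpos)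
      (MeasurableSpace.generateFrom (markedRectangles X n)) _ _ |>.2 fun j => ?_)
    refine Measurable.prod (fun D hD => ?_) fun E hE => ?_
    · have h := key {y | y.1 j ∈ D} univ
        (((measurable_pi_apply j).comp measurable_subtype_coe) hD) MeasurableSet.univ
      simp only [mem_univ, and_true] at h
      exact h
    · have h := key univ {s | s j ∈ E} MeasurableSet.univ (measurable_pi_apply j hE)
      simp only [mem_univ, true_and] at h
      exact h
  · refine MeasurableSpace.generateFrom_le ?_
    rintro _ ⟨Δ, A, hΔ, hA, rfl⟩
    exact (measurable_points hΔ.1).inter (measurable_marks hA)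

/-- The gluing condition fixes the values on rectangles over bounded sets, a π-system containing an
exhaustion of finite mass. Existence of solutions is essential: over a `Δ` without one, the
condition would be void. -/
theorem GluesMomentSolutions.unique {μ : Measure (RadonMeasure X)}
    (hsol : ∀ Δ : Set (OffDiag X n), IsBoundedBorel Δ → ∃ ζ, SolvesMomentProblem μ Δ ζ)
    {ξ ξ' : Measure (MarkedTuple X n)} (h : GluesMomentSolutions μ ξ)
    (h' : GluesMomentSolutions μ ξ') : ξ = ξ' := by
  refine Measure.ext_of_generateFrom_of_iUnion (markedRectangles X n)
    (fun m => {v | v.points ∈ univ ∩ offDiagExhaustion X n m ∧ v.marks ∈ univ})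
    generateFrom_markedRectangles isPiSystem_markedRectangles ?_ (fun m => ?_) (fun m => ?_) ?_
  · refine eq_univ_of_forall fun v => ?_
    have := mem_iUnion.1 (iUnion_offDiagExhaustion (X := X) (n := n) ▸ mem_univ v.points)
    simpa using this
  · exact ⟨_, univ, isBoundedBorel_inter_offDiagExhaustion .univ m, .univ, rfl⟩
  · have hb := isBoundedBorel_inter_offDiagExhaustion (X := X) (n := n) .univ m
    obtain ⟨ζ, hζ⟩ := hsol _ hb
    have := hζ.1
    rw [← h _ hb ζ hζ univ .univ]
    exact measure_ne_top ζ univ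
  · rintro _ ⟨Δ, A, hΔ, hA, rfl⟩
    obtain ⟨ζ, hζ⟩ := hsol Δ hΔ
    rw [← h Δ hΔ ζ hζ A hA, ← h' Δ hΔ ζ hζ A hA]

end Gluing

end RandomDiscrete

end

/-! ### The main theorem. -/

theorem mainTheorem2 {X : Type*} [TopologicalSpace X] [PolishSpace X] [LocallyCompactSpace X]
    [MeasurableSpace X] [BorelSpace X]
    (μ : Measure (RandomDiscrete.RadonMeasure X)) [IsProbabilityMeasure μ]
    (hdiscrete : ∀ᵐ η ∂μ, η ∈ RandomDiscrete.discreteCone X)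
    (hmoments : RandomDiscrete.HasFiniteMoments μ)
    (hC1 : RandomDiscrete.ConditionC1 μ) :
    (∀ n : ℕ, 1 ≤ n → ∀ Δ : Set (RandomDiscrete.OffDiag X n), RandomDiscrete.IsBoundedBorel Δ →
      ∃! ζ : Measure (Fin n → RandomDiscrete.Rpos), RandomDiscrete.SolvesMomentProblem μ Δ ζ) ∧
    (∀ n : ℕ, 1 ≤ n →
      ∃! ξ : Measure (RandomDiscrete.MarkedTuple X n),
        RandomDiscrete.GluesMomentSolutions μ ξ) ∧
    (∃ ρ : Measure (RandomDiscrete.FiniteConfiguration (X × RandomDiscrete.Rpos)),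
      RandomDiscrete.IsCorrelationMeasure (μ.map RandomDiscrete.atomMap) ρ ∧
      (∀ ρ', RandomDiscrete.IsCorrelationMeasure (μ.map RandomDiscrete.atomMap) ρ' → ρ' = ρ) ∧
      ∀ n : ℕ, 1 ≤ n → ∀ ξ : Measure (RandomDiscrete.MarkedTuple X n),
        RandomDiscrete.GluesMomentSolutions μ ξ →
        (∀ σ : Equiv.Perm (Fin n),
          (RandomDiscrete.divideByMarks ξ).map (RandomDiscrete.MarkedTuple.perm σ) =
            RandomDiscrete.divideByMarks ξ) ∧
        (RandomDiscrete.divideByMarks ξ).map RandomDiscrete.MarkedTuple.toFiniteConfiguration =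
          ρ.restrict (RandomDiscrete.configurationsOfCard (X × RandomDiscrete.Rpos) n)) := by
  have hsol : ∀ n : ℕ, 1 ≤ n → ∀ Δ : Set (RandomDiscrete.OffDiag X n), RandomDiscrete.IsBoundedBorel Δ →
      RandomDiscrete.SolvesMomentProblem μ Δ
        (RandomDiscrete.markMeasure (RandomDiscrete.gluedMeasure μ n) Δ) := fun n hn Δ hΔ =>
    RandomDiscrete.solvesMomentProblem_markMeasure hdiscrete hC1 hn hΔ
  have hglue : ∀ n : ℕ, 1 ≤ n → RandomDiscrete.GluesMomentSolutions μ
      (RandomDiscrete.gluedMeasure μ n) := fun n hn =>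
    RandomDiscrete.gluesMomentSolutions_gluedMeasure hdiscrete hC1 hn
  have huniq : ∀ n : ℕ, 1 ≤ n → ∀ ξ : Measure (RandomDiscrete.MarkedTuple X n),
      RandomDiscrete.GluesMomentSolutions μ ξ → ξ = RandomDiscrete.gluedMeasure μ n :=
    fun n hn ξ hξ => hξ.unique (fun Δ hΔ => ⟨_, hsol n hn Δ hΔ⟩) (hglue n hn)
  have hcorr := RandomDiscrete.isCorrelationMeasure_bind (μ.map RandomDiscrete.atomMap)
  refine ⟨fun n hn Δ hΔ => ⟨_, hsol n hn Δ hΔ, fun ζ hζ => hζ.unique hC1 hn hΔ (hsol n hn Δ hΔ)⟩,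
    fun n hn => ⟨_, hglue n hn, huniq n hn⟩, _, hcorr, fun ρ' hρ' => hcorr.unique hρ', ?_⟩
  intro n hn ξ hξ
  -- By uniqueness `ξ` is the explicit measure, and dividing by the marks returns the factorial
  -- measure.
  rw [huniq n hn ξ hξ, RandomDiscrete.divideByMarks_gluedMeasure]
  exact ⟨RandomDiscrete.factorialMeasure_map_perm μ,
    RandomDiscrete.factorialMeasure_map_toFiniteConfiguration μ⟩
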